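/- All graphs are finite, simple and connected unless stated otherwise. For a graph $G$ and pairwise distinct vertices $a,a',b,b'$ of $G$, the tuple $(G,a,a',b,b')$ \emph{satisfies the gluing property} if $a$ and $b$ have degree $3$, $a'$ and $b'$ have degree at least $3$, $aa',bb',ab\in E(G)$ and $ab',a'b,a'b'\notin E(G)$. Given two such tuples $(G_i,a_i,a_i',b_i,b_i')$, $i=1,2$, the \emph{amalgam} of $G_1$ and $G_2$ is the simple graph obtained from the disjoint union of $G_1$ and $G_2$ by deleting the edges $a_1b_1$, $b_1b_1'$, $a_2b_2$, $b_2b_2'$, adding the edges $b_1b_2$, $b_1b_2'$, $b_1'b_2$, and identifying $a_1$ with $a_2$ and $a_1'$ with $a_2'$. Plane embeddings are taken up to homeomorphism of the sphere, that is, as rotation systems (a cyclic order of the edges at each vertex) of genus $0$; for a connected graph with at least one edge the faces are the orbits of the face-tracing permutation, and the vertices and edges traversed by an orbit form the boundary of that face. Vertices $v_0,\dots,v_{k-1}$ are \emph{co-facial} in a plane embedding if they all lie on the boundary of one face. They \emph{appear in this order} in a face $F$ if for every $i$ (indices modulo $k$) there is a $v_iv_{i+1}$-path all of whose edges lie on the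 boundary of $F$ and which contains no $v_j$ with $j\notin\{i,i+1\}$. \textbf{Lemma.} Let $(G_1,a_1,a_1',b_1,b_1')$ and $(G_2,a_2,a_2',b_2,b_2')$ be two tuples satisfying the gluing property, where $G_1$ and $G_2$ are connected planar graphs. Suppose that $G_1$ admits a plane embedding with a face on whose boundary $a_1',a_1,b_1,b_1'$ all lie and in which they appear in this order, and that $G_2$ admits a plane embedding in which $a_2,a_2',b_2,b_2'$ are not co-facial. Then the amalgam of $G_1$ and $G_2$ is planar. -/

import Mathlib

namespace PlaneGraph

open SimpleGraph

variable {V : Type*} {G : SimpleGraph V}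

/-- The permutation of the darts (oriented edges) of `G` that walks along faces: for a rotation
`rot` of the darts around their tails, the dart `u → v` is followed by the dart `v → w` which comes
right after the reversed dart `v → u` in the rotation at `v`. -/
def facePerm (rot : Equiv.Perm G.Dart) : Equiv.Perm G.Dart :=
  rot * Function.Involutive.toPerm Dart.symm Dart.symm_involutive

/-- The faces given by a rotation: the orbits of the face permutation. -/
def FaceOf (rot : Equiv.Perm G.Dart) : Type _ :=
  Quotient (Equiv.Perm.SameCycle.setoid (facePerm rot))

variable (G) in
/-- A plane embedding of a finite graph, given by its rotation system: for every vertex a cyclic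
order of the darts leaving it (the order in which the edges leave the vertex in the drawing), such
that the resulting surface is a sphere (one sphere for every component of the graph).
Each component that has an edge has Euler characteristic at most `2` (vertices minus edges plus
face orbits), and an isolated vertex lies on a sphere with one face, which has no dart. Hence the
equation `euler`, in which the isolated vertices count for these dartless faces, says exactly that
each component is embedded in a sphere. For a connected graph with an edge it is Euler's formula
`|V| - |E| + |F| = 2`. -/
structure PlaneEmbedding where
  /-- the next dart in the cyclic order around the tail of a dart -/
  rot : Equiv.Perm G.Dart
  rot_fst : ∀ d : G.Dart, (rot d).fst = d.fst
  rot_cyclic : ∀ d e : G.Dart, d.fst = e.fst → rot.SameCycle d e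
  euler : Nat.card V + Nat.card (FaceOf rot) + Nat.card {v : V // G.IsIsolated v}
    = Nat.card G.edgeSet + 2 * Nat.card G.ConnectedComponent

variable (G) in
/-- A finite graph is planar if it has a plane embedding. -/
def Planar : Prop := Nonempty (PlaneEmbedding G)

namespace PlaneEmbedding

/-- The faces of a plane embedding (of a connected graph with an edge). -/
abbrev Face (E : PlaneEmbedding G) : Type _ := FaceOf E.rot

/-- The face that a dart runs along (the face on one fixed side of the dart). -/
def faceOfDart (E : PlaneEmbedding G) (d : G.Dart) : E.Face :=
  Quotient.mk (Equiv.Perm.SameCycle.setoid (facePerm E.rot)) d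

/-- The set of vertices on the boundary of a face. -/
def faceVerts (E : PlaneEmbedding G) (F : E.Face) : Set V :=
  {v | ∃ d : G.Dart, E.faceOfDart d = F ∧ d.fst = v}

/-- The set of edges on the boundary of a face. -/
def faceEdges (E : PlaneEmbedding G) (F : E.Face) : Set (Sym2 V) :=
  {e | ∃ d : G.Dart, E.faceOfDart d = F ∧ d.edge = e}

/-- All the vertices `v 0, …, v (k - 1)` lie on the boundary of the face `F`. -/
def OnFace (E : PlaneEmbedding G) (F : E.Face) {k : ℕ} (v : Fin k → V) : Prop :=
  ∀ i, v i ∈ E.faceVerts F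

/-- The vertices `v 0, …, v (k - 1)` are co-facial. -/
def CoFacial (E : PlaneEmbedding G) {k : ℕ} (v : Fin k → V) : Prop :=
  ∃ F : E.Face, E.OnFace F v

/-- The vertices `v 0, …, v (k - 1)` appear in order in `F`: for every `i` (indices modulo `k`)
there is a path from `v i` to `v (i + 1)` all of whose edges are on the boundary of `F` and which
contains no other `v j`. -/
def AppearInOrder (E : PlaneEmbedding G) (F : E.Face) {k : ℕ} [NeZero k] (v : Fin k → V) : Prop :=
  ∀ i : Fin k, ∃ p : G.Walk (v i) (v (i + 1)), p.IsPath ∧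
    (∀ e ∈ p.edges, e ∈ E.faceEdges F) ∧ ∀ j, v j ∈ p.support → j = i ∨ j = i + 1

end PlaneEmbedding

/-- The tuple `(G, a, a', b, b')` satisfies the gluing property. -/
structure GluingProperty [Fintype V] (G : SimpleGraph V) [DecidableRel G.Adj]
    (a a' b b' : V) : Prop where
  distinct : [a, a', b, b'].Nodup
  degree_a : G.degree a = 3
  degree_b : G.degree b = 3
  degree_a' : 3 ≤ G.degree a'
  degree_b' : 3 ≤ G.degree b'
  adj_aa' : G.Adj a a'
  adj_bb' : G.Adj b b'
  adj_ab : G.Adj a b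
  not_adj_ab' : ¬ G.Adj a b'
  not_adj_a'b : ¬ G.Adj a' b
  not_adj_a'b' : ¬ G.Adj a' b'

/-- The identifications made in the amalgam: `a₁ = a₂` and `a₁' = a₂'`. -/
inductive AmalgamRel {V₁ V₂ : Type*} (a₁ a₁' : V₁) (a₂ a₂' : V₂) : V₁ ⊕ V₂ → V₁ ⊕ V₂ → Prop
  | a : AmalgamRel a₁ a₁' a₂ a₂' (Sum.inl a₁) (Sum.inr a₂)
  | a' : AmalgamRel a₁ a₁' a₂ a₂' (Sum.inl a₁') (Sum.inr a₂')

/-- The vertex set of the amalgam: the disjoint union of the two vertex sets with `a₁`, `a₂`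
identified and `a₁'`, `a₂'` identified. -/
def AmalgamVertex {V₁ V₂ : Type*} (a₁ a₁' : V₁) (a₂ a₂' : V₂) : Type _ :=
  Quot (AmalgamRel a₁ a₁' a₂ a₂')

/-- The graph before the identifications: the disjoint union of `G₁` and `G₂` in which the edges
`a₁b₁`, `b₁b₁'`, `a₂b₂`, `b₂b₂'` are deleted and the edges `b₁b₂`, `b₁b₂'`, `b₁'b₂` are added. -/
def preAmalgam {V₁ V₂ : Type*} (G₁ : SimpleGraph V₁) (a₁ b₁ b₁' : V₁)
    (G₂ : SimpleGraph V₂) (a₂ b₂ b₂' : V₂) : SimpleGraph (V₁ ⊕ V₂) :=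
  (G₁.deleteEdges {s(a₁, b₁), s(b₁, b₁')} ⊕g G₂.deleteEdges {s(a₂, b₂), s(b₂, b₂')}) ⊔
    fromEdgeSet {s(Sum.inl b₁, Sum.inr b₂), s(Sum.inl b₁, Sum.inr b₂'),
      s(Sum.inl b₁', Sum.inr b₂)}

/-- The amalgam of `G₁` and `G₂` for the tuples `(G₁, a₁, a₁', b₁, b₁')` and
`(G₂, a₂, a₂', b₂, b₂')`: the image of `preAmalgam` under the identification of `a₁` with `a₂` and
of `a₁'` with `a₂'` (a simple graph). -/
def amalgam {V₁ V₂ : Type*} (G₁ : SimpleGraph V₁) (a₁ a₁' b₁ b₁' : V₁)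
    (G₂ : SimpleGraph V₂) (a₂ a₂' b₂ b₂' : V₂) :
    SimpleGraph (AmalgamVertex a₁ a₁' a₂ a₂') :=
  (preAmalgam G₁ a₁ b₁ b₁' G₂ a₂ b₂ b₂').map (Quot.mk (AmalgamRel a₁ a₁' a₂ a₂'))

end PlaneGraph

/-! The two drawings can be glued along suitable faces. In `G₁`, Jordan curve arguments with the
edges `a₁a₁'`, `b₁b₁'`, `a₁b₁` and the path from `b₁'` to `a₁'` leave, up to reflection, only the
cyclic order `a₁, b₁, b₁', a₁'` of corners around the given face (`exists_isCyc_of_onFace`). In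
`G₂`, since `a₂` and `b₂` have degree 3, the edges `a₂a₂'` and `b₂b₂'` are neighbours of `a₂b₂` in
the rotations at `a₂` and `b₂`. If they lay on the same side of `a₂b₂`, or if both sides belonged to
one face, the four vertices would be co-facial. Hence deleting `a₂b₂` merges two faces into one with
cyclic order `a₂, a₂', b₂, b₂'` (`exists_isCyc_deleted_of_not_coFacial`).

Identifying `a₁` with `a₂` and `a₁'` with `a₂'` inside these faces produces a face with cyclic order
`a', b₂, b₂', a, b₁, b₁'`, in which the chords `b₂b₁'`, `b₂b₁`, `b₁b₂'` do not cross
(`IsSpherical.exists_glue`). Deleting the superfluous edges leaves the amalgam (`planar_amalgam`).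

Drawings are pairs `(σ, α)` of permutations of darts, with the cycles of `σ`, `α` and `σ * α` as
vertices, edges and faces. Every surgery multiplies `σ` by a transposition, and
`IsSpherical.swap_mul` says when genus 0 survives. The Jordan curve argument `not_isCyc_of_walk` is
also a count of cycles, and everything rests on `genus_nonneg`. Deleted or not yet drawn edges stay
in the map as dead edges, both of whose darts are fixed by `σ`. -/

namespace PlaneGraph

open Equiv Equiv.Perm SimpleGraph

/-! ### Partitions, and how a transposition changes the cycles of a permutation -/

section Setoids

variable {D L : Type*}

/-- The partition of `D` into the cycles of a permutation. -/
abbrev cycles (π : Perm D) : Setoid D := SameCycle.setoid π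

/-- The number of classes of a partition. -/
noncomputable def numClasses (r : Setoid D) : ℕ := Nat.card (Quotient r)

/-- The partition whose only nontrivial block is `{x, y}`. -/
def pairSetoid (x y : D) : Setoid D := Relation.EqvGen.setoid fun a b => a = x ∧ b = y

theorem pairSetoid_rel (x y : D) : pairSetoid x y x y := Relation.EqvGen.rel _ _ ⟨rfl, rfl⟩

theorem pairSetoid_le {x y : D} {r : Setoid D} : pairSetoid x y ≤ r ↔ r x y := by
  refine ⟨fun h => h (pairSetoid_rel x y), fun h => Setoid.eqvGen_le ?_⟩
  rintro a b ⟨rfl, rfl⟩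
  exact h

/-- Merging two classes is a change of labels; identifications of vertices are tracked in this form.
-/
theorem ker_sup_pairSetoid [DecidableEq L] (T : D → L) (x y : D) :
    Setoid.ker T ⊔ pairSetoid x y = Setoid.ker (Function.update id (T y) (T x) ∘ T) := by
  apply le_antisymm
  · refine sup_le (fun a b h => ?_) (pairSetoid_le.2 ?_)
    · have h : T a = T b := h
      simp [Setoid.ker_def, h]
    · by_cases h : T x = T y <;> simp [Setoid.ker_def, h]
  · intro a b h
    have h : Function.update id (T y) (T x) (T a) = Function.update id (T y) (T x) (T b) := h
    have key : ∀ c, T c = T y → (Setoid.ker T ⊔ pairSetoid x y) c x := fun c hc =>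
      Setoid.trans' _ (le_sup_left (a := Setoid.ker T) (b := pairSetoid x y) (show Setoid.ker T c y from hc))
        (Setoid.symm' _ (le_sup_right (a := Setoid.ker T) (b := pairSetoid x y) (pairSetoid_rel x y)))
    have triv : ∀ c d, T c = T d → (Setoid.ker T ⊔ pairSetoid x y) c d := fun c d hc =>
      le_sup_left (a := Setoid.ker T) (b := pairSetoid x y) (show Setoid.ker T c d from hc)
    simp only [Function.update_apply, id] at h
    split_ifs at h with h1 h2 h2
    · exact triv _ _ (h1.trans h2.symm)
    · exact Setoid.trans' _ (key a h1) (triv _ _ h)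
    · exact Setoid.trans' _ (triv _ _ h) (Setoid.symm' _ (key b h2))
    · exact triv _ _ h

theorem sup_pairSetoid_of_rel {r : Setoid D} {x y : D} (h : r x y) : r ⊔ pairSetoid x y = r :=
  sup_eq_left.2 (pairSetoid_le.2 h)

theorem numClasses_sup_pairSetoid [Finite D] {r : Setoid D} {x y : D} (h : ¬ r x y) :
    numClasses (r ⊔ pairSetoid x y) + 1 = numClasses r := by
  classical
  have hk : r = Setoid.ker (Quotient.mk r) := (Setoid.ker_mk_eq r).symm
  have hne : Quotient.mk r x ≠ Quotient.mk r y := fun e => h (Quotient.exact e)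
  have h1 : r ⊔ pairSetoid x y = Setoid.ker
      (Function.update id (Quotient.mk r y) (Quotient.mk r x) ∘ Quotient.mk r) := by
    conv_lhs => rw [hk]
    exact ker_sup_pairSetoid _ x y
  have h2 : Set.range (Function.update id (Quotient.mk r y) (Quotient.mk r x) ∘ Quotient.mk r)
      = {Quotient.mk r y}ᶜ := by
    ext q
    simp only [Set.mem_range, Function.comp, Set.mem_compl_iff, Set.mem_singleton_iff,
      Function.update_apply, id]
    constructor
    · rintro ⟨z, rfl⟩
      split_ifs with hz
      · exact hne
      · exact hz
    · intro hq
      obtain ⟨z, rfl⟩ := Quotient.exists_rep q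
      exact ⟨z, if_neg hq⟩
  unfold numClasses
  rw [h1, Nat.card_congr (Setoid.quotientKerEquivRange _), h2, Nat.card_coe_set_eq,
    ← Set.ncard_add_ncard_compl {Quotient.mk r y}, Set.ncard_singleton, add_comm]

theorem numClasses_le [Finite D] {r s : Setoid D} (h : r ≤ s) : numClasses s ≤ numClasses r :=
  Nat.card_le_card_of_surjective (Quotient.map' id fun _ _ hab => h hab)
    fun q => Quotient.inductionOn' q fun a => ⟨Quotient.mk'' a, rfl⟩

theorem numClasses_ker_of_surjective {T : D → L} (h : Function.Surjective T) :
    numClasses (Setoid.ker T) = Nat.card L :=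
  Nat.card_congr (Setoid.quotientKerEquivOfSurjective T h)

theorem cycles_le [Finite D] {π : Perm D} {r : Setoid D} : cycles π ≤ r ↔ ∀ x, r x (π x) := by
  refine ⟨fun h x => h (sameCycle_apply_right.2 (SameCycle.refl π x)), fun h x y hxy => ?_⟩
  obtain ⟨n, -, rfl⟩ := SameCycle.exists_pow_eq' hxy
  induction n with
  | zero => exact Setoid.refl' _ _
  | succ n ih =>
    rw [pow_succ', Perm.mul_apply]
    exact Setoid.trans' _ (ih ⟨n, by simp⟩) (h _)

theorem cycles_apply (π : Perm D) (x : D) : cycles π x (π x) :=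
  sameCycle_apply_right.2 (SameCycle.refl π x)

theorem cycles_mul_le [Finite D] (σ α : Perm D) : cycles (σ * α) ≤ cycles σ ⊔ cycles α :=
  cycles_le.2 fun x => Setoid.trans' _ (le_sup_right (a := cycles σ) (cycles_apply α x))
    (le_sup_left (b := cycles α) (cycles_apply σ (α x)))

theorem cycles_swap_mul_le [Finite D] [DecidableEq D] (x y : D) (π : Perm D) :
    cycles (swap x y * π) ≤ cycles π ⊔ pairSetoid x y := by
  refine cycles_le.2 fun z => ?_
  have h : ∀ w, (cycles π ⊔ pairSetoid x y) w (swap x y w) := by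
    intro w
    have hp := le_sup_right (a := cycles π) (pairSetoid_rel x y)
    by_cases h1 : w = x
    · subst h1; simpa using hp
    · by_cases h2 : w = y
      · subst h2; simpa using Setoid.symm' _ hp
      · rw [swap_apply_of_ne_of_ne h1 h2]
  exact Setoid.trans' _ (le_sup_left (b := pairSetoid x y) (cycles_apply π z)) (h _)

/-- Once `x` and `y` are regarded as equal, the transposition cannot be seen. -/
theorem cycles_swap_mul_sup [Finite D] [DecidableEq D] (x y : D) (π : Perm D) :
    cycles (swap x y * π) ⊔ pairSetoid x y = cycles π ⊔ pairSetoid x y := by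
  apply le_antisymm
  · exact sup_le (cycles_swap_mul_le x y π) le_sup_right
  · refine sup_le ?_ le_sup_right
    simpa using cycles_swap_mul_le x y (swap x y * π)

end Setoids

/-! ### Cycles written as lists: splitting, merging and reversing face walks -/

section Lists

variable {D : Type*}

/-- The list `l` runs once through a cycle of the permutation `φ`. -/
def IsCyc (φ : Perm D) : List D → Prop
  | [] => False
  | x :: l => (x :: l).Nodup ∧ (x :: (l ++ [x])).IsChain fun a b => φ a = b

variable {φ : Perm D} {x y : D} {l l₁ l₂ : List D}

theorem IsCyc.nodup (h : IsCyc φ l) : l.Nodup := by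
  cases l with
  | nil => exact List.nodup_nil
  | cons x l => exact h.1

theorem isCyc_cons_append_cons : IsCyc φ (x :: l₁ ++ y :: l₂) ↔ (x :: l₁ ++ y :: l₂).Nodup ∧
    (x :: (l₁ ++ [y])).IsChain (fun a b => φ a = b) ∧
    (y :: (l₂ ++ [x])).IsChain (fun a b => φ a = b) := by
  have : x :: ((l₁ ++ y :: l₂) ++ [x]) = x :: l₁ ++ y :: (l₂ ++ [x]) := by simp
  rw [List.cons_append, IsCyc, this, List.isChain_split, List.cons_append]

theorem IsCyc.rotate (h : IsCyc φ (l₁ ++ l₂)) : IsCyc φ (l₂ ++ l₁) := by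
  cases l₁ with
  | nil => simpa using h
  | cons x l₁ =>
    cases l₂ with
    | nil => simpa using h
    | cons y l₂ =>
      rw [isCyc_cons_append_cons] at h ⊢
      exact ⟨(List.perm_append_comm.nodup_iff).1 h.1, h.2.2, h.2.1⟩

theorem isChain_swap_mul [DecidableEq D] (a : D) (hx : x ∉ l) (hy : y ∉ l)
    (h : (a :: (l ++ [y])).IsChain fun a b => φ a = b) :
    (a :: (l ++ [x])).IsChain fun a b => (swap x y * φ) a = b := by
  induction l generalizing a with
  | nil =>
    simp only [List.nil_append, List.isChain_cons_cons] at h ⊢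
    exact ⟨by simp [h.1], by simp⟩
  | cons b l ih =>
    simp only [List.mem_cons, not_or] at hx hy
    simp only [List.cons_append, List.isChain_cons_cons] at h ⊢
    refine ⟨?_, ih b hx.2 hy.2 h.2⟩
    rw [Perm.mul_apply, h.1, swap_apply_of_ne_of_ne (Ne.symm hx.1) (Ne.symm hy.1)]

theorem isChain_swap_mul_of_notMem [DecidableEq D] (a : D) (hx : x ∉ l) (hy : y ∉ l)
    (h : (a :: l).IsChain fun a b => φ a = b) :
    (a :: l).IsChain fun a b => (swap x y * φ) a = b := by
  induction l generalizing a with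
  | nil => simp
  | cons b l ih =>
    simp only [List.mem_cons, not_or] at hx hy
    simp only [List.isChain_cons_cons] at h ⊢
    refine ⟨?_, ih b hx.2 hy.2 h.2⟩
    rw [Perm.mul_apply, h.1, swap_apply_of_ne_of_ne (Ne.symm hx.1) (Ne.symm hy.1)]

/-- The swap acts after `φ`, so it only exchanges the two arrows that enter `x` and `y`. -/
theorem IsCyc.split [DecidableEq D] (h : IsCyc φ (x :: l₁ ++ y :: l₂)) :
    IsCyc (swap x y * φ) (x :: l₁) ∧ IsCyc (swap x y * φ) (y :: l₂) := by
  rw [isCyc_cons_append_cons] at h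
  obtain ⟨hn, h1, h2⟩ := h
  have hn' := hn
  simp only [List.cons_append, List.nodup_cons, List.mem_append, List.mem_cons, not_or,
    List.nodup_append] at hn
  refine ⟨⟨hn'.of_append_left, isChain_swap_mul x hn.1.1 ?_ h1⟩,
    ⟨hn'.of_append_right, ?_⟩⟩
  · intro hy
    exact hn.2.2.2 y hy y (by simp) rfl
  · rw [swap_comm]
    exact isChain_swap_mul y hn.2.2.1.1 hn.1.2.2 h2

theorem IsCyc.merge [DecidableEq D] (h₁ : IsCyc φ (x :: l₁)) (h₂ : IsCyc φ (y :: l₂))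
    (hd : (x :: l₁).Disjoint (y :: l₂)) : IsCyc (swap x y * φ) (x :: l₁ ++ y :: l₂) := by
  rw [isCyc_cons_append_cons]
  refine ⟨List.Nodup.append h₁.1 h₂.1 hd, ?_, ?_⟩
  · rw [swap_comm]
    exact isChain_swap_mul x (fun hy => hd (List.mem_cons_of_mem _ hy) (by simp))
      (List.nodup_cons.1 h₁.1).1 h₁.2
  · exact isChain_swap_mul y (fun hx => hd (by simp) (List.mem_cons_of_mem _ hx))
      (List.nodup_cons.1 h₂.1).1 h₂.2

theorem IsCyc.swap_mul [DecidableEq D] (h : IsCyc φ l) (hx : x ∉ l) (hy : y ∉ l) :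
    IsCyc (swap x y * φ) l := by
  cases l with
  | nil => exact h
  | cons a l =>
    refine ⟨h.1, isChain_swap_mul_of_notMem a ?_ ?_ h.2⟩ <;>
    · simp only [List.mem_cons, List.mem_append, List.not_mem_nil, or_false, not_or] at *
      tauto

theorem isChain_sameCycle (h : (x :: l).IsChain fun a b => φ a = b) :
    ∀ z ∈ l, φ.SameCycle x z := by
  induction l generalizing x with
  | nil => simp
  | cons b l ih =>
    simp only [List.isChain_cons_cons] at h
    intro z hz
    have hb : φ.SameCycle x b := h.1 ▸ cycles_apply φ x
    rcases List.mem_cons.1 hz with rfl | hz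
    · exact hb
    · exact hb.trans (ih h.2 z hz)

theorem IsCyc.sameCycle (h : IsCyc φ l) (hx : x ∈ l) (hy : y ∈ l) : φ.SameCycle x y := by
  cases l with
  | nil => exact h.elim
  | cons a l =>
    have key : ∀ z ∈ a :: l, φ.SameCycle a z := fun z hz => isChain_sameCycle h.2 z (by
      simp only [List.mem_cons, List.mem_append, List.not_mem_nil, or_false] at hz ⊢; tauto)
    exact (key x hx).symm.trans (key y hy)

theorem isChain_apply_mem (h : (x :: (l ++ [y])).IsChain fun a b => φ a = b) :
    ∀ z ∈ x :: l, φ z ∈ l ++ [y] := by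
  induction l generalizing x with
  | nil => simpa using h
  | cons b l ih =>
    simp only [List.cons_append, List.isChain_cons_cons] at h
    intro z hz
    rcases List.mem_cons.1 hz with rfl | hz
    · simp [h.1]
    · exact List.mem_cons_of_mem _ (ih h.2 z hz)

theorem IsCyc.apply_mem (h : IsCyc φ l) (hx : x ∈ l) : φ x ∈ l := by
  cases l with
  | nil => exact h.elim
  | cons a l =>
    have := isChain_apply_mem h.2 x hx
    simpa [or_comm] using this

theorem IsCyc.mem_of_sameCycle [Finite D] (h : IsCyc φ l) (hx : x ∈ l) (hxy : φ.SameCycle x y) :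
    y ∈ l := by
  obtain ⟨n, -, rfl⟩ := hxy.exists_pow_eq'
  clear hxy
  induction n with
  | zero => exact hx
  | succ n ih =>
    rw [pow_succ', Perm.mul_apply]
    exact h.apply_mem ih

theorem exists_isCyc [Finite D] (φ : Perm D) (x : D) : ∃ l, IsCyc φ (x :: l) := by
  obtain ⟨n, hn⟩ : ∃ n, Function.minimalPeriod φ x = n + 1 :=
    Nat.exists_eq_succ_of_ne_zero (Function.minimalPeriod_pos_of_mem_periodicPts
      (Function.Injective.mem_periodicPts φ.injective x)).ne'
  refine ⟨(List.range n).map fun i => φ^[i + 1] x, ?_, ?_⟩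
  · have : x :: (List.range n).map (fun i => φ^[i + 1] x) = (List.range (n + 1)).map (φ^[·] x) := by
      rw [List.range_succ_eq_map]; simp [Function.comp_def]
    rw [this]
    refine List.Nodup.map_on (fun i hi j hj hij => ?_) List.nodup_range
    rw [List.mem_range, ← hn] at hi hj
    exact (Function.iterate_injOn_Iio_minimalPeriod (f := φ) (x := x)) hi hj hij
  · have : x :: ((List.range n).map (fun i => φ^[i + 1] x) ++ [x])
        = (List.range (n + 2)).map (φ^[·] x) := by
      rw [List.range_succ, List.range_succ_eq_map, ← hn]
      simp [Function.comp_def, Function.iterate_minimalPeriod]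
    rw [this, List.isChain_map]
    have := (List.isChain_range_succ (fun a b => φ (φ^[a] x) = φ^[b] x) (n + 1)).2
      (fun m _ => by rw [← Function.iterate_succ_apply' φ m x])
    exact this

theorem IsCyc.map {D' : Type*} {ψ : Perm D'} (f : D → D') (hf : Function.Injective f)
    (h : IsCyc φ l) (hψ : ∀ z, ψ (f z) = f (φ z)) : IsCyc ψ (l.map f) := by
  cases l with
  | nil => exact h.elim
  | cons a l =>
    refine ⟨h.1.map hf, ?_⟩
    have : f a :: (l.map f ++ [f a]) = (a :: (l ++ [a])).map f := by simp
    rw [this, List.isChain_map]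
    exact h.2.imp fun a b hab => by rw [hψ, hab]

/-- The face walks of the mirror image. -/
theorem IsCyc.reverse {ψ : Perm D} (f : D → D) (hf : Function.Injective f)
    (h : IsCyc φ l) (hψ : ∀ z, ψ (f (φ z)) = f z) : IsCyc ψ (l.map f).reverse := by
  cases l with
  | nil => exact h.elim
  | cons a l =>
    rw [List.map_cons, List.reverse_cons]
    refine IsCyc.rotate (l₁ := [f a]) (?_ : IsCyc ψ (f a :: (l.map f).reverse))
    refine ⟨?_, ?_⟩
    · exact (List.nodup_cons.2 ⟨by simpa using (List.nodup_cons.1 (h.1.map hf)).1,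
        (List.nodup_reverse.2 (List.nodup_cons.1 (h.1.map hf)).2)⟩)
    · have : f a :: ((l.map f).reverse ++ [f a]) = ((a :: (l ++ [a])).map f).reverse := by simp
      rw [this, List.isChain_reverse, List.isChain_map]
      exact h.2.imp fun a b hab => by rw [← hab, hψ]

variable [Finite D] [DecidableEq D]

theorem not_sameCycle_swap_mul (hxy : x ≠ y) (h : φ.SameCycle x y) :
    ¬ (swap x y * φ).SameCycle x y := by
  obtain ⟨l, hl⟩ := exists_isCyc φ x
  have hy := hl.mem_of_sameCycle (by simp) h
  rcases List.mem_cons.1 hy with hy | hy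
  · exact absurd hy.symm hxy
  · obtain ⟨l₁, l₂, rfl⟩ := List.append_of_mem hy
    rw [← List.cons_append] at hl
    intro hs
    have := hl.split.1.mem_of_sameCycle (by simp) hs
    have hn := hl.nodup
    rw [List.nodup_append] at hn
    exact hn.2.2 y this y (by simp) rfl

theorem sameCycle_swap_mul (h : ¬ φ.SameCycle x y) : (swap x y * φ).SameCycle x y := by
  obtain ⟨l, hl⟩ := exists_isCyc φ x
  obtain ⟨m, hm⟩ := exists_isCyc φ y
  refine (hl.merge hm fun z hz hz' => h ?_).sameCycle (by simp) (by simp)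
  exact (hl.sameCycle (by simp) hz).trans (hm.sameCycle hz' (by simp))

theorem cycles_swap_mul_of_not (h : ¬ φ.SameCycle x y) :
    cycles (swap x y * φ) = cycles φ ⊔ pairSetoid x y := by
  rw [← cycles_swap_mul_sup, sup_pairSetoid_of_rel (sameCycle_swap_mul h)]

theorem numClasses_swap_mul_of_not (h : ¬ φ.SameCycle x y) :
    numClasses (cycles (swap x y * φ)) + 1 = numClasses (cycles φ) := by
  rw [cycles_swap_mul_of_not h, numClasses_sup_pairSetoid h]

theorem numClasses_swap_mul_of_sameCycle (hxy : x ≠ y) (h : φ.SameCycle x y) :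
    numClasses (cycles (swap x y * φ)) = numClasses (cycles φ) + 1 := by
  have := numClasses_swap_mul_of_not (not_sameCycle_swap_mul hxy h)
  rw [swap_mul_self_mul] at this
  exact this.symm

end Lists

/-! ### Nonnegative genus, and surgery that preserves genus 0 -/

section Genus

variable {D : Type*} [Finite D]

/-- The partition of the darts into the connected components of a map. -/
def comps (σ α : Perm D) : Setoid D := cycles σ ⊔ cycles α

theorem comps_swap_mul_sup [DecidableEq D] (x y : D) (σ α : Perm D) :
    comps (swap x y * σ) α ⊔ pairSetoid x y = comps σ α ⊔ pairSetoid x y := by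
  rw [comps, comps, sup_right_comm, cycles_swap_mul_sup, sup_right_comm]

theorem numClasses_cycles_one : numClasses (cycles (1 : Perm D)) = Nat.card D := by
  have : cycles (1 : Perm D) = ⊥ := by
    rw [eq_bot_iff, cycles_le]
    intro x
    exact Setoid.refl' _ _
  rw [this]
  exact Nat.card_congr ⟨Quotient.lift id fun _ _ h => h, Quotient.mk _,
    fun q => Quotient.inductionOn q fun _ => rfl, fun _ => rfl⟩

/-- The genus of a map is not negative. -/
theorem genus_nonneg (σ α : Perm D) :
    numClasses (cycles σ) + numClasses (cycles α) + numClasses (cycles (σ * α))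
      ≤ Nat.card D + 2 * numClasses (comps σ α) := by
  classical
  have : Fintype D := Fintype.ofFinite D
  induction hn : σ.support.card using Nat.strong_induction_on generalizing σ with
  | _ n ih =>
    subst hn
    by_cases h1 : σ = 1
    · subst h1
      have : comps 1 α = cycles α := by
        rw [comps, sup_eq_right, cycles_le]
        intro x
        exact Setoid.refl' _ _
      rw [this, numClasses_cycles_one, one_mul]
      omega
    · obtain ⟨x, hx⟩ : ∃ x, σ x ≠ x := by
        by_contra! h
        exact h1 (Perm.ext h)
      have ih' := ih _ (card_support_swap_mul hx) _ rfl
      -- The permutation `τ` fixes `x`, so its support is smaller. Going back to `σ` costs one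
      -- vertex. If it also costs a face, the left side drops by 2, and at most one component is
      -- lost.
      set y := σ x with hy
      set τ := swap x y * σ with hτ
      have hσ : σ = swap x y * τ := by simp [hτ]
      have hst : ¬ τ.SameCycle x y := not_sameCycle_swap_mul hx.symm (cycles_apply σ x)
      have hV := numClasses_swap_mul_of_not hst
      have hφ : σ * α = swap x y * (τ * α) := by rw [hσ, mul_assoc]
      have hc : comps σ α ⊔ pairSetoid x y = comps τ α ⊔ pairSetoid x y := by
        rw [← comps_swap_mul_sup x y τ, ← hσ]
      have hc1 : comps σ α ⊔ pairSetoid x y = comps σ α :=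
        sup_pairSetoid_of_rel (le_sup_left (b := cycles α) (cycles_apply σ x))
      rw [hc1] at hc
      rw [← hσ] at hV
      rw [hφ]
      by_cases hf : (τ * α).SameCycle x y
      · rw [numClasses_swap_mul_of_sameCycle hx.symm hf]
        rw [sup_pairSetoid_of_rel (show comps τ α x y from cycles_mul_le τ α hf)] at hc
        rw [hc]
        omega
      · have hF := numClasses_swap_mul_of_not hf
        by_cases hr : comps τ α x y
        · rw [sup_pairSetoid_of_rel hr] at hc
          rw [hc]
          omega
        · have := numClasses_sup_pairSetoid hr
          rw [← hc] at this
          omega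

/-- The map with rotation `σ` and edges `α` has genus `0`. -/
def IsSpherical (σ α : Perm D) : Prop :=
  numClasses (cycles σ) + numClasses (cycles α) + numClasses (cycles (σ * α))
    = Nat.card D + 2 * numClasses (comps σ α)

/-- Cutting a vertex into two, or identifying two vertices at corners that lie in one face or in
different components, preserves the genus `0`. -/
theorem IsSpherical.swap_mul [DecidableEq D] {σ α : Perm D} {x y : D} (h : IsSpherical σ α)
    (hxy : σ.SameCycle x y ∨ (σ * α).SameCycle x y ∨ ¬ comps σ α x y) :
    IsSpherical (swap x y * σ) α := by
  by_cases hne : x = y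
  · subst hne
    rwa [swap_self, ← Perm.one_def, one_mul]
  -- In each case the changes in vertices, faces and components must balance; this inequality rules
  -- out the combinations that would give negative genus.
  have hg := genus_nonneg (swap x y * σ) α
  have hc := comps_swap_mul_sup x y σ α
  unfold IsSpherical at *
  rw [mul_assoc] at *
  have hσφ : ∀ {σ : Perm D}, (σ * α).SameCycle x y → comps σ α x y := fun h => cycles_mul_le _ α h
  have hσσ : ∀ {σ : Perm D}, σ.SameCycle x y → comps σ α x y := fun h =>
    le_sup_left (b := cycles α) h
  by_cases h1 : σ.SameCycle x y
  · have e1 := numClasses_swap_mul_of_sameCycle hne h1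
    rw [sup_pairSetoid_of_rel (hσσ h1)] at hc
    by_cases h2 : (σ * α).SameCycle x y
    · have e2 := numClasses_swap_mul_of_sameCycle hne h2
      -- One more vertex and one more face are impossible unless the number of components grows too.
      by_cases h3 : comps (swap x y * σ) α x y
      · rw [sup_pairSetoid_of_rel h3] at hc
        rw [hc] at hg ⊢
        omega
      · have := numClasses_sup_pairSetoid h3
        rw [hc] at this
        omega
    · have e2 := numClasses_swap_mul_of_not h2
      have h3 : comps (swap x y * σ) α x y := hσφ (by
        rw [mul_assoc]; exact sameCycle_swap_mul h2)
      rw [sup_pairSetoid_of_rel h3] at hc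
      rw [hc]
      omega
  · have e1 := numClasses_swap_mul_of_not h1
    have h3 : comps (swap x y * σ) α x y := hσσ (sameCycle_swap_mul h1)
    rw [sup_pairSetoid_of_rel h3] at hc
    by_cases h2 : (σ * α).SameCycle x y
    · have e2 := numClasses_swap_mul_of_sameCycle hne h2
      rw [sup_pairSetoid_of_rel (hσφ h2)] at hc
      rw [hc]
      omega
    · have e2 := numClasses_swap_mul_of_not h2
      have h4 : ¬ comps σ α x y := by tauto
      have := numClasses_sup_pairSetoid h4
      rw [← hc] at this
      omega

end Genus
-- Disjoint unions and mirror images of maps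
section Transport

variable {D D₁ D₂ : Type*}

theorem cycles_le_comap [Finite D] {D' : Type*} {π : Perm D} {π' : Perm D'} (f : D → D')
    (h : ∀ x, π' (f x) = f (π x)) : cycles π ≤ Setoid.comap f (cycles π') :=
  cycles_le.2 fun x => by
    rw [Setoid.comap_rel, ← h]
    exact cycles_apply π' (f x)

theorem comps_le_comap [Finite D] {D' : Type*} {σ α : Perm D} {σ' α' : Perm D'} (f : D → D')
    (hσ : ∀ x, σ' (f x) = f (σ x)) (hα : ∀ x, α' (f x) = f (α x)) :
    comps σ α ≤ Setoid.comap f (comps σ' α') :=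
  sup_le (fun _ _ h => le_sup_left (b := cycles α') (cycles_le_comap f hσ h))
    fun _ _ h => le_sup_right (a := cycles σ') (cycles_le_comap f hα h)

theorem comps_le [Finite D] {σ α : Perm D} {r : Setoid D} :
    comps σ α ≤ r ↔ (∀ x, r x (σ x)) ∧ ∀ x, r x (α x) := by
  rw [comps, sup_le_iff, cycles_le, cycles_le]

theorem numClasses_of_sum [Finite D₁] [Finite D₂] (e : D₁ ⊕ D₂ ≃ D) {r : Setoid D}
    {r₁ : Setoid D₁} {r₂ : Setoid D₂} (h₁ : r₁ ≤ Setoid.comap (e ∘ Sum.inl) r)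
    (h₂ : r₂ ≤ Setoid.comap (e ∘ Sum.inr) r)
    (h : r ≤ Setoid.ker (Sum.map (Quotient.mk r₁) (Quotient.mk r₂) ∘ e.symm)) :
    numClasses r = numClasses r₁ + numClasses r₂ := by
  unfold numClasses
  rw [← Nat.card_sum]
  refine Nat.card_congr ⟨Quotient.lift _ fun _ _ hab => h hab,
    Sum.elim (Quotient.lift (fun x => Quotient.mk r (e (Sum.inl x)))
      fun _ _ hab => Quotient.sound (h₁ hab)) (Quotient.lift (fun x => Quotient.mk r (e (Sum.inr x)))
      fun _ _ hab => Quotient.sound (h₂ hab)), ?_, ?_⟩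
  · intro q
    induction q using Quotient.inductionOn with
    | _ x =>
      obtain ⟨y | y, rfl⟩ := e.surjective x <;> simp
  · rintro (q | q) <;> induction q using Quotient.inductionOn <;> simp

section

variable [Finite D] [Finite D₁] [Finite D₂] (e : D₁ ⊕ D₂ ≃ D) {π σ α : Perm D}
  {π₁ σ₁ α₁ : Perm D₁} {π₂ σ₂ α₂ : Perm D₂}

theorem numClasses_cycles_of_sum (h₁ : ∀ x, π (e (Sum.inl x)) = e (Sum.inl (π₁ x)))
    (h₂ : ∀ x, π (e (Sum.inr x)) = e (Sum.inr (π₂ x))) :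
    numClasses (cycles π) = numClasses (cycles π₁) + numClasses (cycles π₂) := by
  refine numClasses_of_sum e (cycles_le_comap _ h₁) (cycles_le_comap _ h₂) (cycles_le.2 fun x => ?_)
  obtain ⟨y | y, rfl⟩ := e.surjective x
  · simpa [Setoid.ker_def, h₁] using Quotient.sound (s := cycles π₁) <| cycles_apply π₁ y
  · simpa [Setoid.ker_def, h₂] using Quotient.sound (s := cycles π₂) <| cycles_apply π₂ y

/-- All counts are additive, and by `genus_nonneg` neither summand can compensate for a positive
genus of the other. -/
theorem isSpherical_of_sum_iff (hσ₁ : ∀ x, σ (e (Sum.inl x)) = e (Sum.inl (σ₁ x)))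
    (hσ₂ : ∀ x, σ (e (Sum.inr x)) = e (Sum.inr (σ₂ x)))
    (hα₁ : ∀ x, α (e (Sum.inl x)) = e (Sum.inl (α₁ x)))
    (hα₂ : ∀ x, α (e (Sum.inr x)) = e (Sum.inr (α₂ x))) :
    IsSpherical σ α ↔ IsSpherical σ₁ α₁ ∧ IsSpherical σ₂ α₂ := by
  have e1 := numClasses_cycles_of_sum e hσ₁ hσ₂
  have e2 := numClasses_cycles_of_sum e hα₁ hα₂
  have e3 := numClasses_cycles_of_sum (π := σ * α) (π₁ := σ₁ * α₁) (π₂ := σ₂ * α₂) e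
    (fun x => by simp [hα₁, hσ₁]) (fun x => by simp [hα₂, hσ₂])
  have e4 : numClasses (comps σ α) = numClasses (comps σ₁ α₁) + numClasses (comps σ₂ α₂) := by
    refine numClasses_of_sum e (comps_le_comap _ hσ₁ hα₁) (comps_le_comap _ hσ₂ hα₂)
      (comps_le.2 ⟨fun x => ?_, fun x => ?_⟩) <;> obtain ⟨y | y, rfl⟩ := e.surjective x
    · simpa [Setoid.ker_def, hσ₁] using Quotient.sound (s := comps σ₁ α₁) <| le_sup_left (b := cycles α₁) (cycles_apply σ₁ y)
    · simpa [Setoid.ker_def, hσ₂] using Quotient.sound (s := comps σ₂ α₂) <| le_sup_left (b := cycles α₂) (cycles_apply σ₂ y)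
    · simpa [Setoid.ker_def, hα₁] using Quotient.sound (s := comps σ₁ α₁) <| le_sup_right (a := cycles σ₁) (cycles_apply α₁ y)
    · simpa [Setoid.ker_def, hα₂] using Quotient.sound (s := comps σ₂ α₂) <| le_sup_right (a := cycles σ₂) (cycles_apply α₂ y)
  have e5 : Nat.card D = Nat.card D₁ + Nat.card D₂ := by
    rw [← Nat.card_sum, Nat.card_congr e]
  have g1 := genus_nonneg σ₁ α₁
  have g2 := genus_nonneg σ₂ α₂
  unfold IsSpherical
  omega

end

/-- This is the map in which every edge is dead: each cycle of `α` is a component with one face, and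
every dart is its own vertex. -/
theorem isSpherical_one [Finite D] (α : Perm D) : IsSpherical 1 α := by
  have : comps 1 α = cycles α :=
    le_antisymm (comps_le.2 ⟨fun x => Setoid.refl' _ _, cycles_apply α⟩) le_sup_right
  rw [IsSpherical, this, numClasses_cycles_one, one_mul]
  omega

theorem cycles_inv (π : Perm D) : cycles π⁻¹ = cycles π :=
  Setoid.ext fun _ _ => sameCycle_inv

theorem numClasses_cycles_conj (g π : Perm D) :
    numClasses (cycles (g * π * g⁻¹)) = numClasses (cycles π) :=
  Nat.card_congr (Quotient.congr g⁻¹ fun _ _ => sameCycle_conj)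

/-- The mirror image of a spherical map is spherical. -/
theorem IsSpherical.mirror [Finite D] {σ α : Perm D} (h : IsSpherical σ α) (hα : α * α = 1) :
    IsSpherical σ⁻¹ α := by
  have h1 : σ⁻¹ * α = α * (σ * α)⁻¹ * α⁻¹ := by
    have h2 : α⁻¹ = α := inv_eq_of_mul_eq_one_left hα
    rw [mul_inv_rev, h2, ← mul_assoc, hα, one_mul]
  unfold IsSpherical at *
  rw [comps, h1, numClasses_cycles_conj, cycles_inv, cycles_inv]
  exact h

/-- The rotation `σ⁻¹` describes the mirror image; it has the same corners. -/
theorem IsCyc.mirror {σ α : Perm D} {l : List D} (h : IsCyc (σ * α) l) (hα : ∀ x, α (α x) = x) :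
    IsCyc (σ⁻¹ * α) (l.map ⇑σ⁻¹).reverse :=
  h.reverse _ (σ⁻¹).injective fun z => by simp [hα]

end Transport

/-! ### From Euler's formula for graphs to spherical maps and back -/

section Graphs

variable {V : Type*} {G : SimpleGraph V}

/-- The permutation that reverses the darts. -/
abbrev revPerm (G : SimpleGraph V) : Perm G.Dart :=
  Function.Involutive.toPerm Dart.symm Dart.symm_involutive

theorem revPerm_mul_self : revPerm G * revPerm G = 1 := Perm.ext fun d => Dart.symm_symm d

instance finite_dart [Finite V] : Finite G.Dart := by
  classical
  have := Fintype.ofFinite V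
  infer_instance

variable {rot : Perm G.Dart}

theorem numClasses_comps_revPerm (hc : G.Connected)
    (hv : ∀ v, ∃ d : G.Dart, d.fst = v)
    (hrot : ∀ d e, rot.SameCycle d e ↔ d.fst = e.fst) :
    numClasses (comps rot (revPerm G)) = 1 := by
  have key : ∀ u v (p : G.Walk u v) (d e : G.Dart), d.fst = u → e.fst = v →
      comps rot (revPerm G) d e := by
    intro u v p
    induction p with
    | nil =>
      intro d e hd he
      exact le_sup_left (b := cycles (revPerm G)) ((hrot d e).2 (hd.trans he.symm))
    | @cons u w v h p ih =>
      intro d e hd he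
      have h1 : comps rot (revPerm G) d ⟨(u, w), h⟩ :=
        le_sup_left (b := cycles (revPerm G)) ((hrot d _).2 hd)
      have h2 : comps rot (revPerm G) ⟨(u, w), h⟩ ⟨(w, u), h.symm⟩ :=
        le_sup_right (a := cycles rot) (cycles_apply (revPerm G) ⟨(u, w), h⟩)
      exact Setoid.trans' _ (Setoid.trans' _ h1 h2) (ih _ e rfl he)
  obtain ⟨v⟩ := hc.nonempty
  obtain ⟨d, hd⟩ := hv v
  refine Nat.card_eq_one_iff_unique.2 ⟨⟨fun q q' => ?_⟩, ⟨Quotient.mk _ d⟩⟩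
  induction q using Quotient.inductionOn
  induction q' using Quotient.inductionOn
  obtain ⟨p⟩ := hc.preconnected _ _
  exact Quotient.sound (key _ _ p _ _ rfl rfl)

variable [Finite V]

theorem numClasses_cycles_revPerm : numClasses (cycles (revPerm G)) = Nat.card G.edgeSet := by
  have h : cycles (revPerm G) = Setoid.ker Dart.edge := by
    apply le_antisymm
    · exact cycles_le.2 fun d => (Dart.edge_symm d).symm
    · intro d e hde
      rcases (dart_edge_eq_iff d e).1 hde with rfl | rfl
      · exact Setoid.refl' _ _
      · exact Setoid.symm' _ (cycles_apply (revPerm G) e)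
  have hr : Set.range (Dart.edge (G := G)) = G.edgeSet := by
    ext e
    constructor
    · rintro ⟨d, rfl⟩
      exact d.edge_mem
    · induction e with
      | _ u v => exact fun h => ⟨⟨(u, v), h⟩, rfl⟩
  rw [h, numClasses, Nat.card_congr (Setoid.quotientKerEquivRange _), hr]

theorem card_dart : Nat.card G.Dart = 2 * Nat.card G.edgeSet := by
  classical
  have := Fintype.ofFinite V
  rw [Nat.card_eq_fintype_card, dart_card_eq_twice_card_edges, Nat.card_eq_fintype_card,
    edgeFinset_card]

/-- For a connected graph with an edge, Euler's formula says that the rotation is spherical. -/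
theorem euler_iff_isSpherical (hc : G.Connected)
    (hv : ∀ v, ∃ d : G.Dart, d.fst = v)
    (hrot : ∀ d e, rot.SameCycle d e ↔ d.fst = e.fst) :
    Nat.card V + Nat.card (FaceOf rot) + Nat.card {v : V // G.IsIsolated v}
      = Nat.card G.edgeSet + 2 * Nat.card G.ConnectedComponent ↔ IsSpherical rot (revPerm G) := by
  have h1 : numClasses (cycles rot) = Nat.card V := by
    have : cycles rot = Setoid.ker (fun d : G.Dart => d.fst) := Setoid.ext hrot
    rw [this, numClasses_ker_of_surjective hv]
  have h2 : Nat.card {v : V // G.IsIsolated v} = 0 := by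
    have : IsEmpty {v : V // G.IsIsolated v} := ⟨fun ⟨v, h⟩ => by
      obtain ⟨d, rfl⟩ := hv v
      exact h _ d.adj⟩
    exact Nat.card_of_isEmpty
  have h3 : Nat.card G.ConnectedComponent = 1 := by
    have := hc.preconnected.subsingleton_connectedComponent
    obtain ⟨v⟩ := hc.nonempty
    exact Nat.card_eq_one_iff_unique.2 ⟨this, ⟨G.connectedComponentMk v⟩⟩
  have h4 : Nat.card (FaceOf rot) = numClasses (cycles (rot * revPerm G)) := rfl
  rw [IsSpherical, h1, h2, h3, h4, numClasses_comps_revPerm hc hv hrot, numClasses_cycles_revPerm,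
    card_dart]
  omega

theorem PlaneEmbedding.sameCycle_rot_iff (E : PlaneEmbedding G) (d e : G.Dart) :
    E.rot.SameCycle d e ↔ d.fst = e.fst :=
  ⟨fun h => (cycles_le (r := Setoid.ker (fun d : G.Dart => d.fst))).2 (fun d => (E.rot_fst d).symm) h,
    E.rot_cyclic d e⟩

end Graphs

/-- If a spherical map has dead edges (whose darts are fixed by the rotation) and the other darts
are labelled with their tails as the darts of the connected graph `H`, then `H` is planar. -/
theorem planar_of_isSpherical {W D : Type*} [Finite W] [Finite D] {H : SimpleGraph W}
    (hc : H.Connected) (hv : ∀ v, ∃ w, H.Adj v w) {σ α : Perm D} (hs : IsSpherical σ α)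
    (hα : ∀ d, α (α d) = d) (S : Set D) (hS : ∀ d, d ∈ S → α d ∈ S) (lab : D → W)
    (hσS : ∀ d ∈ S, σ d = d) (hσ : ∀ d ∉ S, ∀ e ∉ S, σ.SameCycle d e ↔ lab d = lab e)
    (hadj : ∀ d ∉ S, H.Adj (lab d) (lab (α d)))
    (hsurj : ∀ u v, H.Adj u v → ∃ d ∉ S, lab d = u ∧ lab (α d) = v)
    (hinj : ∀ d ∉ S, ∀ e ∉ S, lab d = lab e → lab (α d) = lab (α e) → d = e) : Planar H := by
  classical
  have hS' : ∀ d, α d ∈ S ↔ d ∈ S := fun d => ⟨fun h => hα d ▸ hS _ h, hS d⟩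
  have hσS' : ∀ d, σ d ∈ S ↔ d ∈ S := fun d =>
    ⟨fun h => by have := σ.injective (hσS _ h); rwa [this] at h, fun h => by rwa [hσS d h]⟩
  let f : {d // d ∉ S} ≃ H.Dart := Equiv.ofBijective
    (fun d => ⟨(lab d, lab (α d)), hadj d d.2⟩) (by
      constructor
      · rintro ⟨d, hd⟩ ⟨e, he⟩ h
        simp only [Dart.mk.injEq, Prod.mk.injEq] at h
        exact Subtype.ext (hinj d hd e he h.1 h.2)
      · rintro ⟨⟨u, v⟩, h⟩
        obtain ⟨d, hd, rfl, rfl⟩ := hsurj u v h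
        exact ⟨⟨d, hd⟩, rfl⟩)
  have hf : ∀ d, (f d).fst = lab d := fun d => rfl
  let rot : Perm H.Dart := f.permCongr (σ.subtypePerm fun d => not_congr (hσS' d))
  have hrot : ∀ d, rot (f d) = f ⟨σ d, (hσS' d).not.2 d.2⟩ := fun d => by
    simp [rot, Equiv.permCongr_apply, Perm.subtypePerm_apply]
  have hrev : ∀ d, revPerm H (f d) = f ⟨α d, (hS' d).not.2 d.2⟩ := fun d => by
    apply Dart.ext
    change (lab (α d), lab d) = (lab (α d), lab (α (α d)))
    rw [hα]
  let e : H.Dart ⊕ {d // d ∈ S} ≃ D := (Equiv.sumComm _ _).trans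
    ((Equiv.sumCongr (Equiv.refl _) f.symm).trans (Equiv.sumCompl (· ∈ S)))
  have he : ∀ d, e (Sum.inl (f d)) = d := fun d => by simp [e]
  have he' : ∀ d, e (Sum.inr d) = d := fun d => by simp [e]
  -- The dead darts form a separate summand with trivial rotation, and a summand of a spherical map
  -- is spherical.
  have hsph : IsSpherical rot (revPerm H) := by
    refine ((isSpherical_of_sum_iff (σ₂ := 1) (α₂ := α.subtypePerm fun d => (hS' d)) e
      ?_ ?_ ?_ ?_).1 hs).1
    · intro d
      obtain ⟨d, rfl⟩ := f.surjective d
      rw [hrot, he, he]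
    · intro d
      rw [Perm.one_apply, he', hσS _ d.2]
    · intro d
      obtain ⟨d, rfl⟩ := f.surjective d
      rw [hrev, he, he]
    · intro d
      rw [he', he', Perm.subtypePerm_apply]
  have hcyc : ∀ d e, rot.SameCycle d e ↔ d.fst = e.fst := by
    intro d e
    obtain ⟨d, rfl⟩ := f.surjective d
    obtain ⟨e, rfl⟩ := f.surjective e
    rw [hf, hf, ← hσ d d.2 e e.2]
    constructor
    · intro h
      have := cycles_le_comap (π' := σ) (fun x => (f.symm x : D)) (fun x => by
        obtain ⟨x, rfl⟩ := f.surjective x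
        simp [hrot]) h
      rw [Setoid.comap_rel] at this
      change σ.SameCycle _ _ at this
      simpa only [Equiv.symm_apply_apply] using this
    · rintro ⟨n, hn⟩
      have : ∀ n : ℕ, ∀ d e : {d // d ∉ S}, (σ ^ n) d = e → rot.SameCycle (f d) (f e) := by
        intro n
        induction n with
        | zero =>
          intro d e h
          rw [Subtype.ext (a1 := d) (a2 := e) h]
        | succ n ih =>
          intro d e h
          refine Setoid.trans' (cycles rot) (cycles_apply rot (f d)) ?_
          rw [hrot]
          exact ih _ e (by rw [← h, pow_succ, Perm.mul_apply])
      obtain ⟨m, -, hm⟩ := SameCycle.exists_pow_eq' (f := σ) ⟨n, hn⟩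
      exact this m d e hm
  have hv' : ∀ v, ∃ d : H.Dart, d.fst = v := fun v =>
    (hv v).elim fun w h => ⟨⟨(v, w), h⟩, rfl⟩
  exact ⟨⟨rot, fun d => ((hcyc _ _).1 (cycles_apply rot d)).symm, fun d e => (hcyc d e).2,
    (euler_iff_isSpherical hc hv' hcyc).2 hsph⟩⟩
-- A combinatorial Jordan curve theorem
section Jordan

variable {V : Type*} [Finite V] {G : SimpleGraph V} {σ : Perm G.Dart}

/-- Four corners `x, p, y, q` that follow each other in this order around a face cannot be such that
the vertices of `x` and `y` are adjacent and those of `p` and `q` are joined by a walk that avoids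
them. -/
theorem not_isCyc_of_walk (hs : IsSpherical σ (revPerm G))
    (hσ : ∀ d e, σ.SameCycle d e ↔ d.fst = e.fst) {x p y q : G.Dart} {l₁ l₂ l₃ l₄ : List G.Dart}
    (hxy : G.Adj x.fst y.fst) (w : G.Walk p.fst q.fst) (hx : x.fst ∉ w.support)
    (hy : y.fst ∉ w.support)
    (h : IsCyc (σ * revPerm G) (x :: (l₁ ++ p :: l₂) ++ y :: (l₃ ++ q :: l₄))) : False := by
  classical
  let e : G.Dart := ⟨(x.fst, y.fst), hxy⟩
  let e' : G.Dart := ⟨(y.fst, x.fst), hxy.symm⟩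
  have he : revPerm G e = e' := rfl
  have he' : revPerm G e' = e := rfl
  have hee : e ≠ e' := fun h => hxy.ne (show e.fst = e'.fst by rw [h])
  have hne : x ≠ y := fun h => hxy.ne (congrArg (fun d : G.Dart => d.fst) h)
  set α := revPerm G with hα
  have hαα : α * α = 1 := revPerm_mul_self
  -- contracting the edge `e`, then cutting the new vertex and the face along `x` and `y`
  set σ₁ := swap e e' * σ with hσ₁
  set τ := σ * swap e e' with hτ
  have hconj : τ = swap e e' * σ₁ * (swap e e')⁻¹ := by
    rw [hσ₁, ← mul_assoc, swap_mul_self, one_mul, swap_inv]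
  set σ' := swap x y * τ with hσ'
  set α' := swap e e' * α with hα'
  have hφ : σ' * α' = swap x y * (σ * α) := by
    rw [hσ', hα', hτ, mul_assoc, mul_assoc, ← mul_assoc (swap e e'), swap_mul_self, one_mul]
  have n1 : ¬ σ.SameCycle e e' := fun h => hxy.ne ((hσ e e').1 h)
  have c1 := cycles_swap_mul_of_not n1
  have N1 := numClasses_swap_mul_of_not n1
  have hτcyc : ∀ d d', τ.SameCycle d d' ↔ σ₁.SameCycle (swap e e' d) (swap e e' d') := fun d d' => by
    rw [hconj, sameCycle_conj, swap_inv]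
  have hσ₁σ : ∀ d d', σ.SameCycle d d' → σ₁.SameCycle d d' := fun d d' h => by
    have : cycles σ ≤ cycles σ₁ := by rw [hσ₁, c1]; exact le_sup_left
    exact this h
  have hsw : ∀ d, σ₁.SameCycle d (swap e e' d) := by
    intro d
    have hp : σ₁.SameCycle e e' := sameCycle_swap_mul n1
    by_cases h1 : d = e
    · subst h1; simpa using hp
    · by_cases h2 : d = e'
      · subst h2; simpa using hp.symm
      · rw [swap_apply_of_ne_of_ne h1 h2]
  have hτσ₁ : cycles τ = cycles σ₁ := Setoid.ext fun d d' => (hτcyc d d').trans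
    ⟨fun h => (hsw d).trans (h.trans (hsw d').symm), fun h => (hsw d).symm.trans (h.trans (hsw d'))⟩
  have s1 : τ.SameCycle x y := by
    have hxe : σ.SameCycle x e := (hσ _ _).2 rfl
    have hye : σ.SameCycle y e' := (hσ _ _).2 rfl
    have : cycles τ x y := by
      rw [hτσ₁]
      exact (hσ₁σ _ _ hxe).trans ((sameCycle_swap_mul n1).trans (hσ₁σ _ _ hye).symm)
    exact this
  have N2 := numClasses_swap_mul_of_sameCycle hne s1
  have s2 : α.SameCycle e e' := he ▸ cycles_apply α e
  have N3 := numClasses_swap_mul_of_sameCycle hee s2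
  have s3 : (σ * α).SameCycle x y := h.sameCycle (by simp) (by simp)
  have N4 := numClasses_swap_mul_of_sameCycle hne s3
  -- Contraction loses a vertex and the cut regains it, while there is one more cycle of `α'` and
  -- one more face. Nonnegative genus therefore demands an additional component.
  have hg := genus_nonneg σ' α'
  -- the cut does not disconnect the map
  have hR : comps σ α ≤ comps σ' α' := by
    have hface : ∀ d d', (swap x y * (σ * α)).SameCycle d d' → comps σ' α' d d' := fun d d' hd => by
      rw [← hφ] at hd
      exact cycles_mul_le σ' α' hd
    -- The cut face falls into one part with `x, p` and one with `y, q`. The walk misses both ends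
    -- of `e`, so it survives and keeps the two parts connected.
    have r1 := hface x p (h.split.1.sameCycle (by simp) (by simp))
    have r2 := hface y q (h.split.2.sameCycle (by simp) (by simp))
    have step : ∀ d, d.fst ≠ x.fst → d.fst ≠ y.fst → σ' d = σ d := by
      intro d h1 h2
      have hd : (σ d).fst = d.fst := ((hσ _ _).1 (cycles_apply σ d)).symm
      rw [hσ', hτ, Perm.mul_apply, Perm.mul_apply, swap_apply_of_ne_of_ne (a := e),
        swap_apply_of_ne_of_ne]
      · rintro rfl; exact h1 hd.symm
      · rintro rfl; exact h2 hd.symm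
      · rintro rfl; exact h1 rfl
      · rintro rfl; exact h2 rfl
    have hvert : ∀ d d' : G.Dart, d.fst ≠ x.fst → d.fst ≠ y.fst → d.fst = d'.fst →
        comps σ' α' d d' := by
      intro d d' h1 h2 hdd
      obtain ⟨n, -, rfl⟩ := SameCycle.exists_pow_eq' ((hσ d d').2 hdd)
      clear hdd
      induction n with
      | zero => exact Setoid.refl' _ _
      | succ n ih =>
        refine Setoid.trans' _ ih ?_
        have hn : ((σ ^ n) d).fst = d.fst := ((hσ _ _).1 ⟨n, by simp⟩).symm
        rw [pow_succ', Perm.mul_apply, ← step _ (hn ▸ h1) (hn ▸ h2)]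
        exact le_sup_left (b := cycles α') (cycles_apply σ' _)
    have hwalk : ∀ u v (w : G.Walk u v), x.fst ∉ w.support → y.fst ∉ w.support →
        ∀ d d' : G.Dart, d.fst = u → d'.fst = v → comps σ' α' d d' := by
      intro u v w
      induction w with
      | nil =>
        intro hx hy d d' hd hd'
        simp only [Walk.support_nil, List.mem_singleton] at hx hy
        exact hvert d d' (fun h => hx (h.symm.trans hd)) (fun h => hy (h.symm.trans hd))
          (hd.trans hd'.symm)
      | @cons u v' v hadj w ih =>
        intro hx hy d d' hd hd'
        simp only [Walk.support_cons, List.mem_cons, not_or] at hx hy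
        let f : G.Dart := ⟨(u, v'), hadj⟩
        have a1 : comps σ' α' d f :=
          hvert d f (fun h => hx.1 (h.symm.trans hd)) (fun h => hy.1 (h.symm.trans hd)) hd
        have a2 : α' f = f.symm := by
          rw [hα', Perm.mul_apply]
          refine swap_apply_of_ne_of_ne (fun h => hy.1 ?_) (fun h => hx.1 ?_)
          · exact congrArg (fun d : G.Dart => d.snd) h.symm
          · exact congrArg (fun d : G.Dart => d.snd) h.symm
        have a3 : comps σ' α' f f.symm := a2 ▸ le_sup_right (a := cycles σ') (cycles_apply α' f)
        exact Setoid.trans' _ (Setoid.trans' _ a1 a3) (ih hx.2 hy.2 _ d' rfl hd')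
    have r3 := hwalk _ _ w hx hy p q rfl rfl
    have rxy : comps σ' α' x y := Setoid.trans' _ (Setoid.trans' _ r1 r3) (Setoid.symm' _ r2)
    -- Undoing the cut joins only darts that are already in one component; the same then holds for
    -- undoing the contraction.
    have hτ' : cycles τ ≤ comps σ' α' := by
      refine le_trans (le_sup_left (b := pairSetoid x y)) ?_
      rw [← cycles_swap_mul_sup]
      exact sup_le le_sup_left (pairSetoid_le.2 rxy)
    have hσ'' : cycles σ ⊔ pairSetoid e e' ≤ comps σ' α' := by
      rw [← c1, ← hσ₁, ← hτσ₁]; exact hτ'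
    refine sup_le (le_sup_left.trans hσ'') ?_
    refine le_trans (le_sup_left (b := pairSetoid e e')) ?_
    rw [← cycles_swap_mul_sup]
    exact sup_le le_sup_right (le_sup_right.trans hσ'')
  have N5 := numClasses_le hR
  rw [hφ] at hg
  rw [← hσ₁, ← hτσ₁] at N1
  rw [← hσ'] at N2
  rw [← hα'] at N3
  unfold IsSpherical at hs
  omega

end Jordan
-- Deleting edges by making their darts fixed points
section Detach

variable {D L : Type*}

open Classical in
/-- The labels of darts when the darts in `S` have been detached from their tails. -/
noncomputable def deadLabel (lab : D → L) (S : Set D) (d : D) : L ⊕ D :=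
  if d ∈ S then Sum.inr d else Sum.inl (lab d)

theorem deadLabel_of_mem {lab : D → L} {S : Set D} {d : D} (h : d ∈ S) :
    deadLabel lab S d = Sum.inr d := if_pos h

theorem deadLabel_of_notMem {lab : D → L} {S : Set D} {d : D} (h : d ∉ S) :
    deadLabel lab S d = Sum.inl (lab d) := if_neg h

theorem deadLabel_eq_iff {lab : D → L} {S : Set D} {d e : D} :
    deadLabel lab S d = deadLabel lab S e ↔ d = e ∨ d ∉ S ∧ e ∉ S ∧ lab d = lab e := by
  by_cases hd : d ∈ S <;> by_cases he : e ∈ S <;>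
    simp only [deadLabel_of_mem, deadLabel_of_notMem, hd, he, Sum.inr.injEq, Sum.inl.injEq,
      reduceCtorEq, not_true_eq_false, not_false_eq_true, true_and, false_and, and_false, or_false,
      false_iff]
  · rintro rfl; exact he hd
  · rintro rfl; exact hd he
  · exact ⟨Or.inr, fun h => h.elim (congrArg lab) id⟩

variable [Finite D] [DecidableEq D]

theorem sameCycle_detach {σ : Perm D} {d x y : D} (hx : x ≠ d) (hy : y ≠ d)
    (h : σ.SameCycle x y) : (swap d (σ d) * σ).SameCycle x y := by
  by_cases hd : σ d = d
  · rwa [hd, swap_self, ← Perm.one_def, one_mul]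
  obtain ⟨l, hl⟩ := exists_isCyc σ d
  by_cases hxd : σ.SameCycle d x
  · have hxl := hl.mem_of_sameCycle (by simp) hxd
    have hyl := hl.mem_of_sameCycle (by simp) (hxd.trans h)
    cases l with
    | nil => exact absurd (List.mem_singleton.1 hxl) hx
    | cons e l =>
      obtain rfl : σ d = e := ((List.isChain_cons_cons (R := fun a b => σ a = b)).1 hl.2).1
      exact (IsCyc.split (l₁ := []) hl).2.sameCycle (List.mem_of_ne_of_mem hx hxl)
        (List.mem_of_ne_of_mem hy hyl)
  · obtain ⟨m, hm⟩ := exists_isCyc σ x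
    refine (hm.swap_mul ?_ ?_).sameCycle (by simp) ?_
    · exact fun hdm => hxd (hm.sameCycle hdm (by simp))
    · exact fun hdm => hxd ((cycles_apply σ d).trans (hm.sameCycle hdm (by simp)))
    · exact hm.mem_of_sameCycle (by simp) h

theorem cycles_detach {σ : Perm D} {lab : D → L} {S : Set D}
    (h : cycles σ = Setoid.ker (deadLabel lab S)) (d : D) :
    cycles (swap d (σ d) * σ) = Setoid.ker (deadLabel lab (insert d S)) := by
  have hσ : ∀ x y, σ.SameCycle x y ↔ x = y ∨ x ∉ S ∧ y ∉ S ∧ lab x = lab y := fun x y => by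
    rw [← deadLabel_eq_iff]
    exact Setoid.ext_iff.1 h x y
  apply le_antisymm
  · refine cycles_le.2 fun x => deadLabel_eq_iff.2 ?_
    by_cases hx : x = d
    · subst hx
      simp
    · have hxx := (hσ _ _).1 (cycles_apply σ x)
      have hdd := (hσ _ _).1 (cycles_apply σ d)
      have hne : σ x ≠ σ d := σ.injective.ne hx
      rw [Perm.mul_apply]
      by_cases h1 : σ x = d
      · rw [h1] at hxx hne ⊢
        rw [swap_apply_left]
        simp only [Set.mem_insert_iff, not_or]
        grind
      · rw [swap_apply_of_ne_of_ne h1 hne]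
        simp only [Set.mem_insert_iff, not_or]
        tauto
  · intro x y hxy
    rcases deadLabel_eq_iff.1 hxy with rfl | ⟨hx, hy, hl⟩
    · exact Setoid.refl' _ _
    · simp only [Set.mem_insert_iff, not_or] at hx hy
      exact sameCycle_detach hx.1 hy.1 ((hσ _ _).2 (Or.inr ⟨hx.2, hy.2, hl⟩))

/-- A dart and its successor lie at one vertex, so this is a vertex cut. Detached darts are kept,
which lets all surgery take place on one fixed type of darts. -/
theorem IsSpherical.detach {σ α : Perm D} (h : IsSpherical σ α) (d : D) :
    IsSpherical (swap d (σ d) * σ) α :=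
  h.swap_mul (Or.inl (cycles_apply σ d))

omit [DecidableEq D] in
theorem IsSpherical.exists_detach {σ α : Perm D} (h : IsSpherical σ α) {lab : D → L} {S : Set D}
    (hσ : cycles σ = Setoid.ker (deadLabel lab S)) (S' : Set D) :
    ∃ σ', IsSpherical σ' α ∧ cycles σ' = Setoid.ker (deadLabel lab (S' ∪ S)) := by
  classical
  induction S', S'.toFinite using Set.Finite.induction_on with
  | empty => exact ⟨σ, h, by rwa [Set.empty_union]⟩
  | insert _ _ ih =>
    obtain ⟨τ, h1, h2⟩ := ih
    exact ⟨_, h1.detach _, by rw [cycles_detach h2, Set.insert_union]⟩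

end Detach

/-! ### The cyclic order on the face of the first graph -/

section OuterFace

variable {V : Type*} [Finite V] {G : SimpleGraph V}

/-- If `a', a, b, b'` lie on a face in such a way that the Jordan curve theorem rules out the other
cyclic orders, then up to reflection their corners follow each other in this order. -/
theorem exists_isCyc_of_onFace {σ : Perm G.Dart} (hs : IsSpherical σ (revPerm G))
    (hσ : ∀ d e, σ.SameCycle d e ↔ d.fst = e.fst) {A A' B B' : G.Dart}
    (haa' : G.Adj A.fst A'.fst) (hbb' : G.Adj B.fst B'.fst) (hab : G.Adj A.fst B.fst)
    (hab' : A.fst ≠ B'.fst) (ha'b : A'.fst ≠ B.fst) (ha'b' : A'.fst ≠ B'.fst)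
    (w : G.Walk B'.fst A'.fst) (ha : A.fst ∉ w.support) (hb : B.fst ∉ w.support)
    (hA' : (σ * revPerm G).SameCycle A A') (hB : (σ * revPerm G).SameCycle A B)
    (hB' : (σ * revPerm G).SameCycle A B') :
    ∃ (τ : Perm G.Dart) (C C' E E' : G.Dart) (l₁ l₂ l₃ l₄ : List G.Dart),
      IsSpherical τ (revPerm G) ∧ (∀ d e, τ.SameCycle d e ↔ d.fst = e.fst) ∧
      C.fst = A.fst ∧ C'.fst = A'.fst ∧ E.fst = B.fst ∧ E'.fst = B'.fst ∧
      IsCyc (τ * revPerm G) (C :: (l₁ ++ E :: (l₂ ++ E' :: (l₃ ++ C' :: l₄)))) := by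
  obtain ⟨l, hl⟩ := exists_isCyc (σ * revPerm G) A
  have mem : ∀ {d}, (σ * revPerm G).SameCycle A d → A.fst ≠ d.fst → d ∈ l := fun h hne =>
    List.mem_of_ne_of_mem (fun h => hne (by rw [h])) (hl.mem_of_sameCycle (by simp) h)
  have mA' := mem hA' haa'.ne
  have mB := mem hB hab.ne
  have mB' := mem hB' hab'
  have nBB' : B ≠ B' := fun h => hbb'.ne (by rw [h])
  have nA'B : A' ≠ B := fun h => ha'b (by rw [h])
  have nA'B' : A' ≠ B' := fun h => ha'b' (by rw [h])
  have wbb' : A.fst ∉ hbb'.toWalk.support ∧ A'.fst ∉ hbb'.toWalk.support := by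
    simp [hab.ne, hab', ha'b, ha'b']
  have wbb'r : A.fst ∉ hbb'.symm.toWalk.support ∧ A'.fst ∉ hbb'.symm.toWalk.support := by
    simp [hab.ne, hab', ha'b, ha'b']
  obtain ⟨k, k', rfl⟩ := List.append_of_mem mB
  have mA'' : A' ∈ k ∨ A' ∈ k' := by simpa [nA'B] using mA'
  have mB'' : B' ∈ k ∨ B' ∈ k' := by simpa [nBB'.symm] using mB'
  -- Of the six cyclic orders, two have `A, A'` separating `B, B'` and two have `A, B` separating
  -- `A', B'`; these contradict `not_isCyc_of_walk`. The other two are mirror images of each other.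
  rcases mA'' with qA | qA <;> rcases mB'' with qB | qB
  · obtain ⟨m, m', rfl⟩ := List.append_of_mem qA
    have mB2 : B' ∈ m ∨ B' ∈ m' := by simpa [nA'B'.symm] using qB
    rcases mB2 with qB | qB
    · obtain ⟨n, n', rfl⟩ := List.append_of_mem qB
      exact (not_isCyc_of_walk hs hσ (x := A) (p := B') (y := A') (q := B) haa' hbb'.symm.toWalk
        wbb'r.1 wbb'r.2 (by simpa using hl)).elim
    · obtain ⟨n, n', rfl⟩ := List.append_of_mem qB
      have inv : ∀ d, (σ⁻¹ d).fst = d.fst := fun d =>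
        (hσ _ _).1 (sameCycle_inv.1 (cycles_apply σ⁻¹ d)).symm
      have h := hl.mirror (Dart.symm_symm)
      rw [List.map_cons, List.reverse_cons] at h
      exact ⟨σ⁻¹, σ⁻¹ A, σ⁻¹ A', σ⁻¹ B, σ⁻¹ B', _, _, _, _, hs.mirror revPerm_mul_self,
        fun d e => sameCycle_inv.trans (hσ d e), inv _, inv _, inv _, inv _,
        by simpa [-inv_mul_cancel] using h.rotate⟩
  · obtain ⟨m, m', rfl⟩ := List.append_of_mem qA
    obtain ⟨n, n', rfl⟩ := List.append_of_mem qB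
    exact (not_isCyc_of_walk hs hσ (x := A) (p := A') (y := B) (q := B') hab w.reverse
      (by simpa using ha) (by simpa using hb) (by simpa using hl)).elim
  · obtain ⟨m, m', rfl⟩ := List.append_of_mem qA
    obtain ⟨n, n', rfl⟩ := List.append_of_mem qB
    exact (not_isCyc_of_walk hs hσ (x := A) (p := B') (y := B) (q := A') hab w
      ha hb (by simpa using hl)).elim
  · obtain ⟨m, m', rfl⟩ := List.append_of_mem qA
    have mB2 : B' ∈ m ∨ B' ∈ m' := by simpa [nA'B'.symm] using qB
    rcases mB2 with qB | qB
    · obtain ⟨n, n', rfl⟩ := List.append_of_mem qB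
      exact ⟨σ, A, A', B, B', k, n, n', m', hs, hσ, rfl, rfl, rfl, rfl, by simpa using hl⟩
    · obtain ⟨n, n', rfl⟩ := List.append_of_mem qB
      exact (not_isCyc_of_walk hs hσ (x := A) (p := B) (y := A') (q := B') haa' hbb'.toWalk
        wbb'.1 wbb'.2 (by simpa using hl)).elim

end OuterFace

/-! ### Deleting `ab` in the second graph -/

section DeletedEdge

variable {V : Type*} [Finite V] {G : SimpleGraph V}

/-- In a rotation system at a vertex of degree at most three any two darts are neighbours. -/
theorem rot_eq_or_of_degree_le {σ : Perm G.Dart} (hσ : ∀ d e, σ.SameCycle d e ↔ d.fst = e.fst)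
    {d e : G.Dart} (hne : d ≠ e) (hde : d.fst = e.fst) [Fintype (G.neighborSet d.fst)]
    (hdeg : G.degree d.fst ≤ 3) : σ d = e ∨ σ e = d := by
  classical
  obtain ⟨l, hl⟩ := exists_isCyc σ d
  have he : e ∈ l := List.mem_of_ne_of_mem hne.symm
    (hl.mem_of_sameCycle (by simp) ((hσ _ _).2 hde))
  have hfst : ∀ x ∈ d :: l, d.fst = x.fst := fun x hx => (hσ _ _).1 (hl.sameCycle (by simp) hx)
  have hlen : (d :: l).length ≤ 3 := by
    have hn : ((d :: l).map fun x => x.snd).Nodup := hl.nodup.map_on fun x hx y hy hxy =>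
      Dart.ext _ _ (Prod.ext ((hfst x hx).symm.trans (hfst y hy)) hxy)
    rw [← List.length_map (fun x : G.Dart => x.snd), ← List.toFinset_card_of_nodup hn]
    refine le_trans (Finset.card_le_card fun v hv => ?_) hdeg
    simp only [List.mem_toFinset, List.mem_map] at hv
    obtain ⟨x, hx, rfl⟩ := hv
    rw [mem_neighborFinset, hfst x hx]
    exact x.adj
  match l, he, hl, hlen with
  | [p], he, hl, _ =>
    have := hl.2
    simp at this he
    simp [this, he]
  | [p, q], he, hl, _ =>
    have := hl.2
    simp at this he
    rcases he with rfl | rfl <;> simp [this]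
  | _ :: _ :: _ :: _, _, _, hlen => simp at hlen; omega

/-- The edge `ab` borders two different faces, one running `ba, aa', …` and the other `ab, bb', …`.
Without the edge they form a single face `aa', …, bb', …`, in which `a'` comes right after `a` and
`b'` right after `b`. -/
theorem exists_isCyc_deleted_of_rot {σ : Perm G.Dart} (hs : IsSpherical σ (revPerm G))
    (hσ : ∀ d e, σ.SameCycle d e ↔ d.fst = e.fst) {a a' b b' : V} (hab : G.Adj a b)
    (haa' : G.Adj a a') (hbb' : G.Adj b b') (hab' : a ≠ b') (ha'b : a' ≠ b)
    (h₁ : σ ⟨(a, b), hab⟩ = ⟨(a, a'), haa'⟩) (h₂ : σ ⟨(b, a), hab.symm⟩ = ⟨(b, b'), hbb'⟩)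
    (hf : ¬ (σ * revPerm G).SameCycle ⟨(a, b), hab⟩ ⟨(b, a), hab.symm⟩) :
    ∃ (τ : Perm G.Dart) (C C' E E' : G.Dart) (m₁ m₂ m₃ m₄ : List G.Dart),
      IsSpherical τ (revPerm G) ∧
      cycles τ = Setoid.ker (deadLabel (fun d : G.Dart => d.fst)
        {⟨(b, a), hab.symm⟩, ⟨(a, b), hab⟩}) ∧
      C.fst = a ∧ C'.fst = a' ∧ E.fst = b ∧ E'.fst = b' ∧ C.snd ≠ b ∧ E.snd ≠ a ∧
      IsCyc (τ * revPerm G) (C :: (m₁ ++ C' :: (m₂ ++ E :: (m₃ ++ E' :: m₄)))) := by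
  classical
  set dab : G.Dart := ⟨(a, b), hab⟩ with hdab
  set dba : G.Dart := ⟨(b, a), hab.symm⟩ with hdba
  set daa : G.Dart := ⟨(a, a'), haa'⟩ with hdaa
  set dbb : G.Dart := ⟨(b, b'), hbb'⟩ with hdbb
  set φ := σ * revPerm G with hφ
  have fst : ∀ d, (σ d).fst = d.fst := fun d => ((hσ _ _).1 (cycles_apply σ d)).symm
  have f1 : φ dba = daa := h₁
  have f2 : φ dab = dbb := h₂
  have hz : (φ daa).fst = a' := fst _
  have hw : (φ dbb).fst = b' := fst _
  obtain ⟨l, hl⟩ := exists_isCyc φ dba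
  obtain ⟨m, hm⟩ := exists_isCyc φ dab
  have hdisj : ∀ z, z ∈ dba :: l → z ∉ dab :: m := fun z h h' =>
    hf ((hm.sameCycle (by simp) h').trans (hl.sameCycle h (by simp)))
  have naa : daa ≠ dba := fun h => hab.ne (show daa.fst = dba.fst by rw [h])
  have nbb : dbb ≠ dab := fun h => hab.ne (show dab.fst = dbb.fst by rw [h])
  have nz : φ daa ≠ dba := fun h => ha'b (hz.symm.trans (show _ = dba.fst by rw [h]))
  have nw : φ dbb ≠ dab := fun h => hab' ((show dab.fst = _ by rw [h]).trans hw)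
  -- The dart after `aa'` leaves `a'`, and `a' ≠ b`, so the face cannot close up before it.
  obtain ⟨l, rfl⟩ : ∃ l', l = daa :: φ daa :: l' := by
    have := hl.2
    match l, this with
    | [], h => simp at h; exact absurd (f1.symm.trans h) naa
    | [p], h =>
      simp only [List.cons_append, List.nil_append, List.isChain_cons_cons] at h
      rw [f1] at h
      exact absurd (h.1 ▸ h.2.1) nz
    | p :: q :: l, h =>
      simp only [List.cons_append, List.isChain_cons_cons] at h
      rw [f1] at h
      exact ⟨l, by rw [h.1, h.2.1]⟩
  obtain ⟨m, rfl⟩ : ∃ m', m = dbb :: φ dbb :: m' := by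
    have := hm.2
    match m, this with
    | [], h => simp at h; exact absurd (f2.symm.trans h) nbb
    | [p], h =>
      simp only [List.cons_append, List.nil_append, List.isChain_cons_cons] at h
      rw [f2] at h
      exact absurd (h.1 ▸ h.2.1) nw
    | p :: q :: l, h =>
      simp only [List.cons_append, List.isChain_cons_cons] at h
      rw [f2] at h
      exact ⟨l, by rw [h.1, h.2.1]⟩
  -- Detaching `ab` merges the two faces. Detaching `ba` afterwards splits off the dead edge as a
  -- face `ba, ab` of its own.
  have hl' : IsCyc φ (daa :: (φ daa :: l ++ [dba])) := hl.rotate (l₁ := [dba])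
  have c1 := hl'.merge hm (fun z h h' => hdisj z (by
    simp only [List.mem_cons, List.mem_append, List.not_mem_nil, or_false] at h ⊢; tauto) h')
  rw [swap_comm] at c1
  have c2 : IsCyc (swap dab daa * φ) (dba :: [dab] ++ dbb :: (φ dbb :: m ++ daa :: φ daa :: l)) := by
    have : IsCyc (swap dab daa * φ) (daa :: φ daa :: l ++ dba :: dab :: dbb :: φ dbb :: m) := by
      simpa using c1
    simpa using this.rotate
  have e1 : (swap dab (σ dab) * σ) dba = dbb := by
    rw [Perm.mul_apply, h₁, h₂, swap_apply_of_ne_of_ne nbb]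
    exact fun h => hab.ne (show daa.fst = dbb.fst by rw [h])
  have c3 := (c2.split.2).rotate (l₁ := dbb :: φ dbb :: m) (l₂ := daa :: φ daa :: l)
  have s0 : cycles σ = Setoid.ker (deadLabel (fun d : G.Dart => d.fst) ∅) := Setoid.ext fun d e => by
    rw [Setoid.ker_def, deadLabel_eq_iff]
    refine (hσ d e).trans ⟨fun h => Or.inr ⟨id, id, h⟩, ?_⟩
    rintro (rfl | h)
    · rfl
    · exact h.2.2
  have s2 := cycles_detach (cycles_detach s0 dab) dba
  have s3 := (hs.detach dab).detach dba
  rw [e1, h₁] at s2 s3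
  refine ⟨_, daa, φ daa, dbb, φ dbb, [], l, [], m, s3, ?_, rfl, hz, rfl, hw, ha'b, hab'.symm, ?_⟩
  · rw [s2]; simp
  · simpa [mul_assoc] using c3

/-- If the four vertices are not co-facial, then after the deletion of the edge `ab` (and up to
reflection) they lie on a face in the cyclic order `a, a', b, b'`. -/
theorem exists_isCyc_deleted_of_not_coFacial (E : PlaneEmbedding G) (hc : G.Connected)
    {a a' b b' : V} [Fintype (G.neighborSet a)] [Fintype (G.neighborSet b)]
    (hE : ¬ E.CoFacial ![a, a', b, b']) (hab : G.Adj a b)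
    (haa' : G.Adj a a') (hbb' : G.Adj b b') (hab' : a ≠ b') (ha'b : a' ≠ b)
    (hda : G.degree a ≤ 3) (hdb : G.degree b ≤ 3) :
    ∃ (τ : Perm G.Dart) (C C' E E' : G.Dart) (m₁ m₂ m₃ m₄ : List G.Dart),
      IsSpherical τ (revPerm G) ∧
      cycles τ = Setoid.ker (deadLabel (fun d : G.Dart => d.fst)
        {⟨(b, a), hab.symm⟩, ⟨(a, b), hab⟩}) ∧
      C.fst = a ∧ C'.fst = a' ∧ E.fst = b ∧ E'.fst = b' ∧ C.snd ≠ b ∧ E.snd ≠ a ∧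
      IsCyc (τ * revPerm G) (C :: (m₁ ++ C' :: (m₂ ++ E :: (m₃ ++ E' :: m₄)))) := by
  have hv : ∀ v, ∃ d : G.Dart, d.fst = v := fun v => by
    have : Nontrivial V := ⟨a, b, hab.ne⟩
    obtain ⟨w, hw⟩ := hc.preconnected.exists_adj_of_nontrivial v
    exact ⟨⟨(v, w), hw⟩, rfl⟩
  have hσ := E.sameCycle_rot_iff
  have hs := (euler_iff_isSpherical hc hv hσ).1 E.euler
  set σ := E.rot with hrot
  set φ := σ * revPerm G with hφ
  set dab : G.Dart := ⟨(a, b), hab⟩ with hdab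
  set dba : G.Dart := ⟨(b, a), hab.symm⟩ with hdba
  set daa : G.Dart := ⟨(a, a'), haa'⟩ with hdaa
  set dbb : G.Dart := ⟨(b, b'), hbb'⟩ with hdbb
  have fst : ∀ d, (σ d).fst = d.fst := E.rot_fst
  have hcof : ∀ x y z w : G.Dart, x.fst = a → y.fst = a' → z.fst = b → w.fst = b' →
      φ.SameCycle x y → φ.SameCycle x z → φ.SameCycle x w → False := by
    intro x y z w hx hy hz hw h1 h2 h3
    refine hE ⟨E.faceOfDart x, fun i => ?_⟩
    fin_cases i
    · exact ⟨x, rfl, hx⟩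
    · exact ⟨y, Quotient.sound h1.symm, hy⟩
    · exact ⟨z, Quotient.sound h2.symm, hz⟩
    · exact ⟨w, Quotient.sound h3.symm, hw⟩
  have nx : ∀ x, φ.SameCycle x (φ x) := cycles_apply φ
  have ha : σ dab = daa ∨ σ daa = dab := rot_eq_or_of_degree_le hσ
    (fun h => ha'b (show daa.snd = dab.snd by rw [h])) rfl hda
  have hb : σ dba = dbb ∨ σ dbb = dba := rot_eq_or_of_degree_le hσ
    (fun h => hab' (show dba.snd = dbb.snd by rw [h])) rfl hdb
  have p1 : σ dab = daa → φ.SameCycle dba daa := fun h => h ▸ nx dba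
  have p2 : σ daa = dab → φ.SameCycle daa.symm dab := fun h => h ▸ nx daa.symm
  have p3 : σ dba = dbb → φ.SameCycle dab dbb := fun h => h ▸ nx dab
  have p4 : σ dbb = dba → φ.SameCycle dbb.symm dba := fun h => h ▸ nx dbb.symm
  -- In the mixed cases `aa'` and `bb'` are on the same side of `ab`, whose face then contains all
  -- four vertices. Otherwise they are on opposite sides, and these are different faces, again
  -- because the vertices are not co-facial.
  rcases ha with ha | ha <;> rcases hb with hb | hb
  · refine exists_isCyc_deleted_of_rot hs hσ hab haa' hbb' hab' ha'b ha hb fun h => ?_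
    exact hcof dab (φ daa) dba (φ dbb) rfl (fst _) rfl (fst _)
      ((h.trans (p1 ha)).trans (nx _)) h ((p3 hb).trans (nx _))
  · exact (hcof daa (φ daa) dba dbb.symm rfl (fst _) rfl rfl (nx _) (p1 ha).symm
      ((p4 hb).trans (p1 ha)).symm).elim
  · exact (hcof dab daa.symm dbb (φ dbb) rfl rfl rfl (fst _) (p2 ha).symm (p3 hb)
      ((p3 hb).trans (nx _))).elim
  · refine exists_isCyc_deleted_of_rot (hs.mirror revPerm_mul_self)
      (fun d e => sameCycle_inv.trans (hσ d e)) hab haa' hbb' hab' ha'b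
      (inv_eq_iff_eq.2 ha.symm) (inv_eq_iff_eq.2 hb.symm) fun h => ?_
    have hconj : σ⁻¹ * revPerm G = revPerm G * φ⁻¹ * (revPerm G)⁻¹ := by
      have h2 : (revPerm G)⁻¹ = revPerm G := inv_eq_of_mul_eq_one_left revPerm_mul_self
      rw [hφ, mul_inv_rev, h2, ← mul_assoc, revPerm_mul_self, one_mul]
    rw [hconj, sameCycle_conj, sameCycle_inv] at h
    have h : φ.SameCycle dba dab := h
    exact hcof dab daa.symm dba dbb.symm rfl rfl rfl rfl (p2 ha).symm h.symm
      (h.symm.trans (p4 hb).symm)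

end DeletedEdge
theorem IsSpherical.sumCongr {D₁ D₂ : Type*} [Finite D₁] [Finite D₂] {σ₁ α₁ : Perm D₁}
    {σ₂ α₂ : Perm D₂} (h₁ : IsSpherical σ₁ α₁) (h₂ : IsSpherical σ₂ α₂) :
    IsSpherical (Perm.sumCongr σ₁ σ₂) (Perm.sumCongr α₁ α₂) :=
  (isSpherical_of_sum_iff (Equiv.refl _) (σ₁ := σ₁) (α₁ := α₁) (σ₂ := σ₂) (α₂ := α₂)
    (fun _ => rfl) (fun _ => rfl) (fun _ => rfl) (fun _ => rfl)).2 ⟨h₁, h₂⟩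

/-! ### Identifying vertices and drawing chords -/

section Labels

variable {D L : Type*} [Finite D] [DecidableEq D] {σ α : Perm D} {lab : D → L} {S : Set D}

theorem cycles_identify [DecidableEq L] (hσ : cycles σ = Setoid.ker (deadLabel lab S)) {x y : D}
    (hx : x ∉ S) (hy : y ∉ S) (hxy : lab x ≠ lab y) :
    cycles (swap x y * σ) =
      Setoid.ker (deadLabel (Function.update id (lab y) (lab x) ∘ lab) S) := by
  have hn : ¬ σ.SameCycle x y := fun h => by
    have : cycles σ x y := h
    rw [hσ, Setoid.ker_def, deadLabel_eq_iff] at this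
    rcases this with rfl | h
    · exact hxy rfl
    · exact hxy h.2.2
  rw [cycles_swap_mul_of_not hn, hσ, ker_sup_pairSetoid]
  congr 1
  funext z
  rw [deadLabel_of_notMem hx, deadLabel_of_notMem hy, Function.comp_apply]
  by_cases hz : z ∈ S
  · simp [deadLabel_of_mem hz]
  · by_cases h : lab z = lab y <;> simp [deadLabel_of_notMem hz, h]

/-- The inverse of detaching: the fixed point `y` is inserted just before `x` in the rotation at the
vertex of `x`. -/
theorem cycles_attach (hσ : cycles σ = Setoid.ker (deadLabel lab S)) {x y : D}
    (hx : x ∉ S) (hy : y ∈ S) (hxy : lab y = lab x) :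
    cycles (swap x y * σ) = Setoid.ker (deadLabel lab (S \ {y})) := by
  classical
  have hne : x ≠ y := fun h => hx (h ▸ hy)
  have hn : ¬ σ.SameCycle x y := fun h => by
    have : cycles σ x y := h
    rw [hσ, Setoid.ker_def, deadLabel_eq_iff] at this
    exact this.elim hne fun h => h.2.1 hy
  rw [cycles_swap_mul_of_not hn, hσ, ker_sup_pairSetoid]
  congr 1
  funext z
  rw [deadLabel_of_notMem hx, deadLabel_of_mem hy, Function.comp_apply]
  by_cases hz : z ∈ S
  · by_cases h : z = y
    · subst h
      rw [deadLabel_of_mem hz, deadLabel_of_notMem (by simp), Function.update_self, hxy]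
    · rw [deadLabel_of_mem hz, deadLabel_of_mem (show z ∈ S \ {y} from ⟨hz, h⟩), Function.update_of_ne (by simpa using h), id]
  · rw [deadLabel_of_notMem hz, deadLabel_of_notMem (show z ∉ S \ {y} from fun h => hz h.1),
      Function.update_of_ne (by simp), id]

omit [Finite D] [DecidableEq D] in
theorem apply_eq_of_mem_dead (hσ : cycles σ = Setoid.ker (deadLabel lab S)) {d : D} (hd : d ∈ S) :
    σ d = d := by
  have : cycles σ d (σ d) := cycles_apply σ d
  rw [hσ, Setoid.ker_def, deadLabel_eq_iff] at this
  exact this.elim Eq.symm fun h => absurd hd h.1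

/-- A dead edge `{d, e}` can be drawn as a chord between the corners `x` and `y` of a face. -/
theorem IsSpherical.exists_chord (h : IsSpherical σ α)
    (hσ : cycles σ = Setoid.ker (deadLabel lab S)) {x y d e : D} {l₁ l₂ : List D}
    (hl : IsCyc (σ * α) (x :: l₁ ++ y :: l₂)) (hx : x ∉ S) (hy : y ∉ S) (hd : d ∈ S) (he : e ∈ S)
    (hde : d ≠ e) (hαd : α d = e) (hαe : α e = d) (hdx : lab d = lab x) (hey : lab e = lab y) :
    ∃ σ', IsSpherical σ' α ∧ cycles σ' = Setoid.ker (deadLabel lab (S \ {d, e})) ∧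
      IsCyc (σ' * α) (e :: x :: l₁) := by
  have hxd : x ≠ d := fun h => hx (h ▸ hd)
  have hxe : x ≠ e := fun h => hx (h ▸ he)
  have hyd : y ≠ d := fun h => hy (h ▸ hd)
  have hye : y ≠ e := fun h => hy (h ▸ he)
  have hσd := apply_eq_of_mem_dead hσ hd
  have hσe := apply_eq_of_mem_dead hσ he
  have hcyc : IsCyc (σ * α) [d, e] := ⟨by simp [hde], by simp [hαd, hαe, hσd, hσe]⟩
  have hdisj : (x :: l₁ ++ y :: l₂).Disjoint [d, e] := fun z h1 h2 => by
    have := hcyc.mem_of_sameCycle h2 (hl.sameCycle h1 (y := x) (by simp))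
    simp [hxd, hxe] at this
  -- A dead edge is a whole component, so attaching its first end joins two components.
  have hcomp : ¬ comps σ α x d := fun hc => by
    have : comps σ α ≤ Setoid.ker fun z => z = d ∨ z = e := by
      refine comps_le.2 ⟨fun z => propext ?_, fun z => propext ?_⟩
      · constructor
        · rintro (rfl | rfl)
          · exact Or.inl hσd
          · exact Or.inr hσe
        · rintro (h | h)
          · exact Or.inl (σ.injective (h.trans hσd.symm))
          · exact Or.inr (σ.injective (h.trans hσe.symm))
      · constructor
        · rintro (rfl | rfl)
          · exact Or.inr hαd
          · exact Or.inl hαe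
        · rintro (h | h)
          · exact Or.inr (α.injective (h.trans hαe.symm))
          · exact Or.inl (α.injective (h.trans hαd.symm))
    have h2 : (x = d ∨ x = e) = (d = d ∨ d = e) := this hc
    simp [hxd, hxe] at h2
  have s1 := h.swap_mul (Or.inr (Or.inr hcomp))
  have c1 := cycles_attach hσ hx hd hdx
  -- The pendant edge has been absorbed by the face, which now contains the corners `y` and `e`;
  -- attaching the second end cuts this face in two.
  have l1 : IsCyc (swap x d * σ * α) (y :: (l₂ ++ [d]) ++ e :: x :: l₁) := by
    have h1 := hl.merge hcyc hdisj
    have h2 := IsCyc.rotate (l₁ := x :: l₁) (l₂ := y :: l₂ ++ [d, e]) (by simpa using h1)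
    simpa [mul_assoc] using h2
  have s2 := s1.swap_mul (x := y) (y := e) (Or.inr (Or.inl (l1.sameCycle (by simp) (by simp))))
  have c2 := cycles_attach c1 (x := y) (y := e) (fun h => hy h.1) ⟨he, hde.symm⟩ hey
  refine ⟨_, s2, ?_, by simpa [mul_assoc] using l1.split.2⟩
  rw [c2, Set.sdiff_sdiff, Set.singleton_union]

/-- Two corners `A, C` in different components are identified, then the corners `A', C'`, and three
dead edges are drawn as chords of the resulting face. -/
theorem IsSpherical.exists_glue [DecidableEq L] (s0 : IsSpherical σ α)
    (c0 : cycles σ = Setoid.ker (deadLabel lab S))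
    {A A' B B' C C' E E' : D} {l₁ l₂ l₃ l₄ m₁ m₂ m₃ m₄ : List D}
    (hl : IsCyc (σ * α) (A :: (l₁ ++ B :: (l₂ ++ B' :: (l₃ ++ A' :: l₄)))))
    (hm : IsCyc (σ * α) (C :: (m₁ ++ C' :: (m₂ ++ E :: (m₃ ++ E' :: m₄)))))
    (hAC : ¬ comps σ α A C) (hA : A ∉ S) (hA' : A' ∉ S) (hB : B ∉ S) (hB' : B' ∉ S)
    (hC : C ∉ S) (hC' : C' ∉ S) (hE : E ∉ S) (hE' : E' ∉ S) (nAC : lab A ≠ lab C)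
    (nAC' : Function.update id (lab C) (lab A) (lab A') ≠
      Function.update id (lab C) (lab A) (lab C'))
    {c : Fin 3 × Bool → D} (hc : Function.Injective c) (hcS : ∀ k, c k ∈ S)
    (hαc : ∀ k t, α (c (k, t)) = c (k, !t))
    (lab0 : lab (c (0, false)) = lab B') (lab0' : lab (c (0, true)) = lab E)
    (lab1 : lab (c (1, false)) = lab B) (lab1' : lab (c (1, true)) = lab E)
    (lab2 : lab (c (2, false)) = lab B) (lab2' : lab (c (2, true)) = lab E') :
    ∃ σ', IsSpherical σ' α ∧ cycles σ' = Setoid.ker (deadLabel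
      (Function.update id (Function.update id (lab C) (lab A) (lab C'))
        (Function.update id (lab C) (lab A) (lab A')) ∘
          Function.update id (lab C) (lab A) ∘ lab) (S \ Set.range c)) := by
  have s1 := s0.swap_mul (Or.inr (Or.inr hAC))
  have c1 := cycles_identify c0 hA hC nAC
  have f1 := hl.merge hm fun z hz hz' => hAC (cycles_mul_le σ α
    ((hl.sameCycle (by simp) hz).trans (hm.sameCycle hz' (by simp))))
  have f1' : IsCyc (swap A C * σ * α) (A' :: (l₄ ++ C :: m₁) ++ C' :: (m₂ ++ E :: (m₃ ++
      E' :: (m₄ ++ A :: (l₁ ++ B :: (l₂ ++ B' :: l₃)))))) := by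
    have := IsCyc.rotate (l₁ := A :: (l₁ ++ B :: (l₂ ++ B' :: l₃)))
      (l₂ := A' :: (l₄ ++ C :: (m₁ ++ C' :: (m₂ ++ E :: (m₃ ++ E' :: m₄))))) (by simpa using f1)
    simpa [mul_assoc] using this
  have s2 := s1.swap_mul (Or.inr (Or.inl (f1'.sameCycle (x := A') (y := C') (by simp) (by simp))))
  have c2 := cycles_identify c1 hA' hC' nAC'
  -- Of the two faces, the one kept has the cyclic order `C', E, E', A, B, B'`. Each chord below
  -- cuts off a part that is no longer needed: `E B'` the corner `C'`, and `E B` the corners `B` and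
  -- `B'`.
  have f2 := f1'.split.2
  rw [← mul_assoc] at f2
  set lab' := Function.update id (Function.update id (lab C) (lab A) (lab C'))
    (Function.update id (lab C) (lab A) (lab A')) ∘
      Function.update id (lab C) (lab A) ∘ lab with hlab'
  have hlab : ∀ {x y}, lab x = lab y → lab' x = lab' y := fun h => by
    simp only [hlab', Function.comp_apply, h]
  obtain ⟨σ₃, s3, c3, f3⟩ := s2.exists_chord (lab := lab') (S := S) c2 (x := E) (y := B')
    (d := c (0, true)) (e := c (0, false)) (l₁ := m₃ ++ E' :: (m₄ ++ A :: (l₁ ++ B :: l₂)))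
    (l₂ := l₃ ++ C' :: m₂)
    (by
      have := IsCyc.rotate (l₁ := C' :: m₂)
        (l₂ := E :: (m₃ ++ E' :: (m₄ ++ A :: (l₁ ++ B :: (l₂ ++ B' :: l₃))))) (by simpa using f2)
      simpa using this)
    hE hB' (hcS _) (hcS _) (by simp [hc.eq_iff]) (hαc _ _) (hαc _ _) (hlab lab0') (hlab lab0)
  obtain ⟨σ₄, s4, c4, f4⟩ := s3.exists_chord c3 (x := E) (y := B)
    (d := c (1, true)) (e := c (1, false)) (l₁ := m₃ ++ E' :: (m₄ ++ A :: l₁))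
    (l₂ := l₂ ++ [c (0, false)])
    (by
      have := IsCyc.rotate (l₁ := [c (0, false)]) (l₂ := E :: (m₃ ++ E' :: (m₄ ++ A ::
        (l₁ ++ B :: l₂)))) (by simpa using f3)
      simpa using this)
    (fun h => hE h.1) (fun h => hB h.1) ⟨hcS _, by simp [hc.eq_iff]⟩
    ⟨hcS _, by simp [hc.eq_iff]⟩ (by simp [hc.eq_iff]) (hαc _ _) (hαc _ _) (hlab lab1') (hlab lab1)
  -- The corner `B` now lies on the other side of the second chord, so the third chord starts at the
  -- corner of the dart `c (1, false)`, which is at the same vertex.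
  obtain ⟨σ₅, s5, c5, -⟩ := s4.exists_chord c4 (x := c (1, false)) (y := E')
    (d := c (2, false)) (e := c (2, true)) (l₁ := E :: m₃) (l₂ := m₄ ++ A :: l₁)
    (by simpa using f4) (fun h => h.2 (by simp)) (fun h => hE' h.1.1)
    ⟨⟨hcS _, by simp [hc.eq_iff]⟩, by simp [hc.eq_iff]⟩
    ⟨⟨hcS _, by simp [hc.eq_iff]⟩, by simp [hc.eq_iff]⟩ (by simp [hc.eq_iff]) (hαc _ _) (hαc _ _)
    (hlab (lab2.trans lab1.symm)) (hlab lab2')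
  refine ⟨σ₅, s5, ?_⟩
  rw [c5]
  congr 2
  ext z
  constructor
  · rintro ⟨⟨⟨h, h1⟩, h2⟩, h3⟩
    refine ⟨h, ?_⟩
    rintro ⟨⟨k, t⟩, rfl⟩
    fin_cases k <;> cases t <;> simp at h1 h2 h3
  · rintro ⟨h, hz⟩
    have hz : ∀ k, z ≠ c k := fun k hk => hz ⟨k, hk.symm⟩
    exact ⟨⟨⟨h, by simp [hz]⟩, by simp [hz]⟩, by simp [hz]⟩

end Labels

/-! ### The glued map on the darts of both graphs and of three new edges -/

section Glue

variable {D₁ D₂ V₁ V₂ : Type*}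

/-- The tails of the two darts of each of the three new edges. -/
def chordLabel (b₁ b₁' : V₁) (b₂ b₂' : V₂) (k : Fin 3 × Bool) : V₁ ⊕ V₂ :=
  if k.2 then Sum.inr (![b₂, b₂, b₂'] k.1) else Sum.inl (![b₁', b₁, b₁] k.1)

/-- The tails of the darts of the two maps and of the new edges. -/
def glueLabel (lab₁ : D₁ → V₁) (lab₂ : D₂ → V₂) (b₁ b₁' : V₁) (b₂ b₂' : V₂) :
    (D₁ ⊕ D₂) ⊕ (Fin 3 × Bool) → V₁ ⊕ V₂ :=
  Sum.elim (Sum.map lab₁ lab₂) (chordLabel b₁ b₁' b₂ b₂')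

/-- The reversal of darts after three edges have been added to the disjoint union of two maps. -/
def glueRev (α₁ : Perm D₁) (α₂ : Perm D₂) : Perm ((D₁ ⊕ D₂) ⊕ (Fin 3 × Bool)) :=
  Perm.sumCongr (Perm.sumCongr α₁ α₂) (Equiv.prodCongr (Equiv.refl _) Equiv.boolNot)

/-- The identification of `a₂` with `a₁` and of `a₂'` with `a₁'`. -/
def identify [DecidableEq V₁] [DecidableEq V₂] (a₁ a₁' : V₁) (a₂ a₂' : V₂) :
    V₁ ⊕ V₂ → V₁ ⊕ V₂ :=
  Function.update id (Sum.inr a₂') (Sum.inl a₁') ∘ Function.update id (Sum.inr a₂) (Sum.inl a₁)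

theorem exists_glue [Finite D₁] [Finite D₂] [DecidableEq V₁] [DecidableEq V₂]
    {σ₁ α₁ : Perm D₁} {σ₂ α₂ : Perm D₂} (h₁ : IsSpherical σ₁ α₁) (h₂ : IsSpherical σ₂ α₂)
    {lab₁ : D₁ → V₁} {lab₂ : D₂ → V₂} {S₂ : Set D₂} (hσ₁ : cycles σ₁ = Setoid.ker lab₁)
    (hσ₂ : cycles σ₂ = Setoid.ker (deadLabel lab₂ S₂))
    {A A' B B' : D₁} {l₁ l₂ l₃ l₄ : List D₁} {C C' E E' : D₂} {m₁ m₂ m₃ m₄ : List D₂}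
    (hl : IsCyc (σ₁ * α₁) (A :: (l₁ ++ B :: (l₂ ++ B' :: (l₃ ++ A' :: l₄)))))
    (hm : IsCyc (σ₂ * α₂) (C :: (m₁ ++ C' :: (m₂ ++ E :: (m₃ ++ E' :: m₄)))))
    (hC : C ∉ S₂) (hC' : C' ∉ S₂) (hE : E ∉ S₂) (hE' : E' ∉ S₂) (hCC' : lab₂ C ≠ lab₂ C') :
    ∃ σ, IsSpherical σ (glueRev α₁ α₂) ∧ cycles σ = Setoid.ker (deadLabel
      (identify (lab₁ A) (lab₁ A') (lab₂ C) (lab₂ C') ∘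
        glueLabel lab₁ lab₂ (lab₁ B) (lab₁ B') (lab₂ E) (lab₂ E'))
      {d | ∃ x ∈ S₂, d = Sum.inl (Sum.inr x)}) := by
  classical
  let i₁ : D₁ → (D₁ ⊕ D₂) ⊕ (Fin 3 × Bool) := fun x => Sum.inl (Sum.inl x)
  let i₂ : D₂ → (D₁ ⊕ D₂) ⊕ (Fin 3 × Bool) := fun x => Sum.inl (Sum.inr x)
  have hi₁ : Function.Injective i₁ := Sum.inl_injective.comp Sum.inl_injective
  have hi₂ : Function.Injective i₂ := Sum.inl_injective.comp Sum.inr_injective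
  let σ : Perm ((D₁ ⊕ D₂) ⊕ (Fin 3 × Bool)) := Perm.sumCongr (Perm.sumCongr σ₁ σ₂) 1
  have hσ1 : ∀ x, σ (i₁ x) = i₁ (σ₁ x) := fun x => rfl
  have hσ2 : ∀ x, σ (i₂ x) = i₂ (σ₂ x) := fun x => rfl
  have s0 : IsSpherical σ (glueRev α₁ α₂) := by
    exact (h₁.sumCongr h₂).sumCongr (isSpherical_one _)
  let lab := glueLabel lab₁ lab₂ (lab₁ B) (lab₁ B') (lab₂ E) (lab₂ E')
  -- The three new edges start out dead, beside the dead darts of the second map.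
  let S₀ : Set ((D₁ ⊕ D₂) ⊕ (Fin 3 × Bool)) := Sum.elim (Sum.elim (fun _ => False) S₂) fun _ => True
  have hS2 : ∀ x, i₂ x ∈ S₀ ↔ x ∈ S₂ := fun x => Iff.rfl
  have hS1 : ∀ x, i₁ x ∉ S₀ := fun x h => h
  have c0 : cycles σ = Setoid.ker (deadLabel lab S₀) := by
    have e1 := Setoid.ext_iff.1 hσ₁
    have e2 := Setoid.ext_iff.1 hσ₂
    simp only [Setoid.ker_def] at e1 e2
    apply le_antisymm
    · refine cycles_le.2 fun z => deadLabel_eq_iff.2 ?_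
      rcases z with (x | x) | k
      · exact Or.inr ⟨hS1 x, hS1 _, congrArg Sum.inl ((e1 _ _).1 (cycles_apply σ₁ x))⟩
      · rcases deadLabel_eq_iff.1 ((e2 _ _).1 (cycles_apply σ₂ x)) with h | ⟨h1, h2, h3⟩
        · exact Or.inl (congrArg i₂ h)
        · exact Or.inr ⟨h1, h2, congrArg Sum.inr h3⟩
      · exact Or.inl rfl
    · intro z w hzw
      rcases deadLabel_eq_iff.1 hzw with rfl | ⟨hz, hw, hlab⟩
      · exact Setoid.refl' _ _
      rcases z with (x | x) | k
      · rcases w with (y | y) | k'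
        · exact cycles_le_comap i₁ hσ1 ((e1 x y).2 (Sum.inl_injective hlab))
        · exact absurd hlab (by simp [lab, glueLabel])
        · exact absurd trivial hw
      · rcases w with (y | y) | k'
        · exact absurd hlab (by simp [lab, glueLabel])
        · exact cycles_le_comap i₂ hσ2 ((e2 x y).2 (deadLabel_eq_iff.2 (Or.inr
            ⟨hz, hw, Sum.inr_injective hlab⟩)))
        · exact absurd trivial hw
      · exact absurd trivial hz
  have hl' := hl.map (ψ := σ * glueRev α₁ α₂) i₁ hi₁ (fun x => rfl)
  have hm' := hm.map (ψ := σ * glueRev α₁ α₂) i₂ hi₂ (fun x => rfl)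
  simp only [List.map_cons, List.map_append] at hl' hm'
  have hcomp : ¬ comps σ (glueRev α₁ α₂) (i₁ A) (i₂ C) := fun hc => by
    have : comps σ (glueRev α₁ α₂) ≤
        Setoid.ker (Sum.elim (fun z => z.isLeft) (fun _ => false)) := by
      refine comps_le.2 ⟨fun z => ?_, fun z => ?_⟩ <;> rcases z with (x | x) | k <;> rfl
    exact Bool.noConfusion (this hc : true = false)
  obtain ⟨τ, h3, h4⟩ := s0.exists_glue c0 hl' hm' hcomp (hS1 _) (hS1 _) (hS1 _) (hS1 _) hC hC' hE hE'
    (by simp [lab, glueLabel, i₁, i₂]) (by simp [lab, glueLabel, i₁, i₂, hCC'.symm])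
    (c := Sum.inr) Sum.inr_injective (fun _ => trivial) (fun _ _ => rfl) rfl rfl rfl rfl rfl rfl
  refine ⟨τ, h3, ?_⟩
  rw [h4]
  congr 2
  · simp [lab, glueLabel, i₁, i₂, hCC'.symm, identify, Function.comp_assoc]
  · ext z
    rcases z with (x | x) | k
    · simpa using hS1 x
    · simpa using hS2 x
    · simp

end Glue
-- Vertices, edges and connectedness of the amalgam
section Amalgam

variable {V₁ V₂ : Type*}

/-- The projection onto the vertices of the amalgam. -/
def amalgamMk (a₁ a₁' : V₁) (a₂ a₂' : V₂) : V₁ ⊕ V₂ → AmalgamVertex a₁ a₁' a₂ a₂' :=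
  Quot.mk _

section Identify

variable [DecidableEq V₁] [DecidableEq V₂] {a₁ a₁' : V₁} {a₂ a₂' : V₂}

theorem identify_inl (u : V₁) : identify a₁ a₁' a₂ a₂' (Sum.inl u) = Sum.inl u := by
  simp [identify]

theorem identify_inr (h : a₂ ≠ a₂') (v : V₂) : identify a₁ a₁' a₂ a₂' (Sum.inr v) =
    if v = a₂ then Sum.inl a₁ else if v = a₂' then Sum.inl a₁' else Sum.inr v := by
  by_cases h1 : v = a₂
  · simp [identify, h1]
  · by_cases h2 : v = a₂' <;> simp [identify, h1, h2, h.symm]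

theorem identify_inr_eq_inl (h : a₂ ≠ a₂') {u : V₁} {v : V₂} :
    identify a₁ a₁' a₂ a₂' (Sum.inr v) = Sum.inl u ↔ v = a₂ ∧ u = a₁ ∨ v = a₂' ∧ u = a₁' := by
  rw [identify_inr h]
  split_ifs with h1 h2 <;> grind

theorem identify_inr_injective (h : a₂ ≠ a₂') (h' : a₁ ≠ a₁') {u v : V₂}
    (he : identify a₁ a₁' a₂ a₂' (Sum.inr u) = identify a₁ a₁' a₂ a₂' (Sum.inr v)) : u = v := by
  rw [identify_inr h, identify_inr h] at he
  split_ifs at he <;> grind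

/-- `identify` picks a representative of each class of the quotient, in the first summand where
possible; with `a₂ ≠ a₂'` its two updates do not interfere. -/
theorem amalgamMk_eq_iff (h : a₂ ≠ a₂') {x y : V₁ ⊕ V₂} :
    amalgamMk a₁ a₁' a₂ a₂' x = amalgamMk a₁ a₁' a₂ a₂' y ↔
      identify a₁ a₁' a₂ a₂' x = identify a₁ a₁' a₂ a₂' y := by
  have hmk : ∀ z, amalgamMk a₁ a₁' a₂ a₂' (identify a₁ a₁' a₂ a₂' z) = amalgamMk a₁ a₁' a₂ a₂' z := by
    rintro (z | z)
    · rw [identify_inl]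
    · rw [identify_inr h]
      split_ifs with h1 h2
      · subst h1; exact Quot.sound .a
      · subst h2; exact Quot.sound .a'
      · rfl
  constructor
  · intro hxy
    refine congrArg (Quot.lift (identify a₁ a₁' a₂ a₂') ?_) hxy
    rintro _ _ (_ | _)
    · rw [identify_inl, identify_inr h, if_pos rfl]
    · rw [identify_inl, identify_inr h, if_neg h.symm, if_pos rfl]
  · intro hxy
    rw [← hmk x, ← hmk y, hxy]

end Identify

variable {G₁ : SimpleGraph V₁} {G₂ : SimpleGraph V₂} {a₁ a₁' b₁ b₁' : V₁} {a₂ a₂' b₂ b₂' : V₂}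

theorem preAmalgam_adj_inl {u v : V₁} : (preAmalgam G₁ a₁ b₁ b₁' G₂ a₂ b₂ b₂').Adj
    (Sum.inl u) (Sum.inl v) ↔ G₁.Adj u v ∧ s(u, v) ∉ ({s(a₁, b₁), s(b₁, b₁')} : Set (Sym2 V₁)) := by
  simp [preAmalgam]

theorem preAmalgam_adj_inr {u v : V₂} : (preAmalgam G₁ a₁ b₁ b₁' G₂ a₂ b₂ b₂').Adj
    (Sum.inr u) (Sum.inr v) ↔ G₂.Adj u v ∧ s(u, v) ∉ ({s(a₂, b₂), s(b₂, b₂')} : Set (Sym2 V₂)) := by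
  simp [preAmalgam]

theorem preAmalgam_adj_inl_inr {u : V₁} {v : V₂} : (preAmalgam G₁ a₁ b₁ b₁' G₂ a₂ b₂ b₂').Adj
    (Sum.inl u) (Sum.inr v) ↔ u = b₁ ∧ v = b₂ ∨ u = b₁ ∧ v = b₂' ∨ u = b₁' ∧ v = b₂ := by
  simp [preAmalgam]

/-- No edge collapses to a loop: each new edge has an end `b₁` or `b₂`, and neither of these is
identified with another vertex. -/
theorem amalgam_adj_of (ha : a₁ ≠ a₁') (ha₂ : a₂ ≠ a₂') (hb₁ : b₁ ≠ a₁ ∧ b₁ ≠ a₁')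
    (hb₂ : b₂ ≠ a₂ ∧ b₂ ≠ a₂') {x y : V₁ ⊕ V₂}
    (h : (preAmalgam G₁ a₁ b₁ b₁' G₂ a₂ b₂ b₂').Adj x y) :
    (amalgam G₁ a₁ a₁' b₁ b₁' G₂ a₂ a₂' b₂ b₂').Adj (amalgamMk a₁ a₁' a₂ a₂' x) (amalgamMk a₁ a₁' a₂ a₂' y) := by
  classical
  refine map_adj_apply' h fun he => ?_
  replace he := (amalgamMk_eq_iff ha₂).1 he
  have key : ∀ {u : V₁} {v : V₂}, (preAmalgam G₁ a₁ b₁ b₁' G₂ a₂ b₂ b₂').Adj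
      (Sum.inl u) (Sum.inr v) → identify a₁ a₁' a₂ a₂' (Sum.inr v) ≠ Sum.inl u := by
    intro u v h he
    rw [preAmalgam_adj_inl_inr] at h
    rw [identify_inr_eq_inl ha₂] at he
    grind
  rcases x with x | x <;> rcases y with y | y
  · rw [identify_inl, identify_inl] at he
    exact (preAmalgam_adj_inl.1 h).1.ne (Sum.inl_injective he)
  · rw [identify_inl] at he
    exact key h he.symm
  · rw [identify_inl] at he
    exact key h.symm he
  · exact (preAmalgam_adj_inr.1 h).1.ne (identify_inr_injective ha₂ ha he)

/-- Both deleted edges of `G₁` contain `b₁`, so `w` survives. The ends of the deleted edge `a₁b₁`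
remain joined by the detour from `a₁` over `a₁'`, `w` reversed, `b₁'` and `b₂` to `b₁`; the other
deleted edges are bypassed by parts of it and the new edges. -/
theorem amalgam_connected (hc₁ : G₁.Connected) (hc₂ : G₂.Connected) (ha : a₁ ≠ a₁')
    (ha₂ : a₂ ≠ a₂') (hb₁ : b₁ ≠ a₁ ∧ b₁ ≠ a₁') (hb₂ : b₂ ≠ a₂ ∧ b₂ ≠ a₂') (haa' : G₁.Adj a₁ a₁')
    (w : G₁.Walk b₁' a₁') (hw : b₁ ∉ w.support) :
    (amalgam G₁ a₁ a₁' b₁ b₁' G₂ a₂ a₂' b₂ b₂').Connected := by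
  set H := amalgam G₁ a₁ a₁' b₁ b₁' G₂ a₂ a₂' b₂ b₂' with hH
  let R : V₁ ⊕ V₂ → V₁ ⊕ V₂ → Prop := fun x y => H.Reachable (amalgamMk a₁ a₁' a₂ a₂' x) (amalgamMk a₁ a₁' a₂ a₂' y)
  have hadj : ∀ {x y}, (preAmalgam G₁ a₁ b₁ b₁' G₂ a₂ b₂ b₂').Adj x y → R x y := fun h =>
    (amalgam_adj_of ha ha₂ hb₁ hb₂ h).reachable
  have r1 : R (.inl b₁) (.inr b₂) := hadj (preAmalgam_adj_inl_inr.2 (by simp))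
  have r2 : R (.inl b₁) (.inr b₂') := hadj (preAmalgam_adj_inl_inr.2 (by simp))
  have r3 : R (.inl b₁') (.inr b₂) := hadj (preAmalgam_adj_inl_inr.2 (by simp))
  have r4 : R (.inl a₁) (.inl a₁') := hadj (preAmalgam_adj_inl.2 ⟨haa', by
    simp only [Set.mem_insert_iff, Set.mem_singleton_iff, Sym2.eq_iff]; grind⟩)
  have r5 : R (.inl b₁') (.inl a₁') := by
    have key : ∀ u v (w : G₁.Walk u v), b₁ ∉ w.support → R (.inl u) (.inl v) := by
      intro u v w
      induction w with
      | nil => exact fun _ => Reachable.refl _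
      | cons h p ih =>
        intro hs
        have hs' := hs
        simp only [Walk.support_cons, List.mem_cons, not_or] at hs
        have := p.start_mem_support
        refine Reachable.trans (hadj (preAmalgam_adj_inl.2 ⟨h, ?_⟩)) (ih hs.2)
        simp only [Set.mem_insert_iff, Set.mem_singleton_iff, Sym2.eq_iff]
        grind
    exact key _ _ w hw
  have r6 : R (.inl a₁) (.inr a₂) := by
    have : amalgamMk a₁ a₁' a₂ a₂' (.inl a₁) = amalgamMk a₁ a₁' a₂ a₂' (.inr a₂) := Quot.sound .a
    change H.Reachable _ _
    rw [this]
  have q : R (.inl a₁) (.inl b₁) := r4.trans (r5.symm.trans (r3.trans r1.symm))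
  have s1 : ∀ {u v}, G₁.Adj u v → R (.inl u) (.inl v) := by
    intro u v h
    by_cases he : s(u, v) ∈ ({s(a₁, b₁), s(b₁, b₁')} : Set (Sym2 V₁))
    · have q' : R (.inl b₁) (.inl b₁') := r1.trans r3.symm
      simp only [Set.mem_insert_iff, Set.mem_singleton_iff, Sym2.eq_iff] at he
      rcases he with (⟨rfl, rfl⟩ | ⟨rfl, rfl⟩) | ⟨rfl, rfl⟩ | ⟨rfl, rfl⟩
      exacts [q, q.symm, q', q'.symm]
    · exact hadj (preAmalgam_adj_inl.2 ⟨h, he⟩)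
  have s2 : ∀ {u v}, G₂.Adj u v → R (.inr u) (.inr v) := by
    intro u v h
    by_cases he : s(u, v) ∈ ({s(a₂, b₂), s(b₂, b₂')} : Set (Sym2 V₂))
    · have q1 : R (.inr a₂) (.inr b₂) := r6.symm.trans (q.trans r1)
      have q2 : R (.inr b₂) (.inr b₂') := r1.symm.trans r2
      simp only [Set.mem_insert_iff, Set.mem_singleton_iff, Sym2.eq_iff] at he
      rcases he with (⟨rfl, rfl⟩ | ⟨rfl, rfl⟩) | ⟨rfl, rfl⟩ | ⟨rfl, rfl⟩
      exacts [q1, q1.symm, q2, q2.symm]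
    · exact hadj (preAmalgam_adj_inr.2 ⟨h, he⟩)
  have t1 : ∀ u, R (.inl a₁) (.inl u) := by
    intro u
    obtain ⟨p⟩ := hc₁.preconnected a₁ u
    have key : ∀ u v (w : G₁.Walk u v), R (.inl u) (.inl v) := by
      intro u v w
      induction w with
      | nil => exact Reachable.refl _
      | cons h p ih => exact (s1 h).trans ih
    exact key _ _ p
  have t2 : ∀ u, R (.inl a₁) (.inr u) := by
    intro u
    obtain ⟨p⟩ := hc₂.preconnected a₂ u
    have key : ∀ u v (w : G₂.Walk u v), R (.inr u) (.inr v) := by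
      intro u v w
      induction w with
      | nil => exact Reachable.refl _
      | cons h p ih => exact (s2 h).trans ih
    exact r6.trans (key _ _ p)
  have t : ∀ U, H.Reachable (amalgamMk a₁ a₁' a₂ a₂' (.inl a₁)) U := by
    rintro ⟨x | x⟩
    exacts [t1 x, t2 x]
  exact (connected_iff _).2 ⟨fun U W => (t U).symm.trans (t W), ⟨amalgamMk a₁ a₁' a₂ a₂' (.inl a₁)⟩⟩

end Amalgam

theorem planar_amalgam {V₁ V₂ : Type*} [Finite V₁] [Finite V₂] {G₁ : SimpleGraph V₁}
    {G₂ : SimpleGraph V₂} {a₁ a₁' b₁ b₁' : V₁} {a₂ a₂' b₂ b₂' : V₂}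
    (n₁ : [a₁, a₁', b₁, b₁'].Nodup) (n₂ : [a₂, a₂', b₂, b₂'].Nodup)
    (haa₁ : G₁.Adj a₁ a₁') (haa₂ : G₂.Adj a₂ a₂')
    (hc : (amalgam G₁ a₁ a₁' b₁ b₁' G₂ a₂ a₂' b₂ b₂').Connected)
    {σ : Perm ((G₁.Dart ⊕ G₂.Dart) ⊕ (Fin 3 × Bool))} [DecidableEq V₁] [DecidableEq V₂]
    (hs : IsSpherical σ (glueRev (revPerm G₁) (revPerm G₂))) {S₀ : Set G₂.Dart}
    (hS₀ : ∀ d ∈ S₀, d.edge = s(a₂, b₂))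
    (hσ : cycles σ = Setoid.ker (deadLabel (identify a₁ a₁' a₂ a₂' ∘
      glueLabel (fun d : G₁.Dart => d.fst) (fun d : G₂.Dart => d.fst) b₁ b₁' b₂ b₂')
      {d | ∃ x ∈ S₀, d = Sum.inl (Sum.inr x)})) :
    Planar (amalgam G₁ a₁ a₁' b₁ b₁' G₂ a₂ a₂' b₂ b₂') := by
  have : Finite (AmalgamVertex a₁ a₁' a₂ a₂') := inferInstanceAs (Finite (Quot _))
  have na : a₁ ≠ a₁' := haa₁.ne
  have na₂ : a₂ ≠ a₂' := haa₂.ne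
  simp only [List.nodup_cons, List.mem_cons, List.not_mem_nil, or_false, not_or,
    List.nodup_nil, and_true, not_false_eq_true] at n₁ n₂
  -- Besides the edges deleted in the amalgam, `a₂a₂'` must die, because the identification makes it
  -- parallel to `a₁a₁'`.
  let S : Set ((G₁.Dart ⊕ G₂.Dart) ⊕ (Fin 3 × Bool)) := Sum.elim
    (Sum.elim (fun d => d.edge ∈ ({s(a₁, b₁), s(b₁, b₁')} : Set (Sym2 V₁)))
      fun d => d.edge ∈ ({s(a₂, b₂), s(b₂, b₂'), s(a₂, a₂')} : Set (Sym2 V₂))) fun _ => False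
  have hSS : S ∪ {d | ∃ x ∈ S₀, d = Sum.inl (Sum.inr x)} = S := by
    rw [Set.union_eq_left]
    rintro _ ⟨x, hx, rfl⟩
    exact Or.inl (hS₀ x hx)
  obtain ⟨τ, hτ, cτ⟩ := hs.exists_detach hσ S
  rw [hSS] at cτ
  let gl := glueLabel (fun d : G₁.Dart => d.fst) (fun d : G₂.Dart => d.fst) b₁ b₁' b₂ b₂'
  set α := glueRev (revPerm G₁) (revPerm G₂) with hα
  have g1 : ∀ d : G₁.Dart, gl (.inl (.inl d)) = .inl d.fst := fun d => rfl
  have g1' : ∀ d : G₁.Dart, gl (α (.inl (.inl d))) = .inl d.snd := fun d => rfl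
  have g2 : ∀ d : G₂.Dart, gl (.inl (.inr d)) = .inr d.fst := fun d => rfl
  have g2' : ∀ d : G₂.Dart, gl (α (.inl (.inr d))) = .inr d.snd := fun d => rfl
  have g3 : ∀ k, gl (.inr (k, false)) = .inl (![b₁', b₁, b₁] k) := fun k => rfl
  have g3' : ∀ k, gl (.inr (k, true)) = .inr (![b₂, b₂, b₂'] k) := fun k => rfl
  have g4 : ∀ k t, α (.inr (k, t)) = .inr (k, !t) := fun k t => rfl
  have hnt : Nontrivial (AmalgamVertex a₁ a₁' a₂ a₂') :=
    ⟨amalgamMk a₁ a₁' a₂ a₂' (.inl a₁), amalgamMk a₁ a₁' a₂ a₂' (.inl a₁'), fun h => na (by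
      rw [amalgamMk_eq_iff na₂, identify_inl, identify_inl] at h
      exact Sum.inl_injective h)⟩
  have chord_adj : ∀ k, (preAmalgam G₁ a₁ b₁ b₁' G₂ a₂ b₂ b₂').Adj
      (.inl (![b₁', b₁, b₁] k)) (.inr (![b₂, b₂, b₂'] k)) := by
    intro k
    rw [preAmalgam_adj_inl_inr]
    fin_cases k <;> simp
  have hk : ∀ {k}, ![b₂, b₂, b₂'] k ≠ a₂ ∧ ![b₂, b₂, b₂'] k ≠ a₂' := by
    intro k
    fin_cases k <;> simp <;> grind
  have hkinj : ∀ {k k'}, ![b₁', b₁, b₁] k = ![b₁', b₁, b₁] k' →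
      ![b₂, b₂, b₂'] k = ![b₂, b₂, b₂'] k' → k = k' := by
    intro k k'
    fin_cases k <;> fin_cases k' <;> simp <;> grind
  have hb₁k : ∀ {k}, ![b₁', b₁, b₁] k ≠ a₁ ∧ ![b₁', b₁, b₁] k ≠ a₁' := by
    intro k
    fin_cases k <;> simp <;> grind
  refine planar_of_isSpherical hc (fun v => hc.preconnected.exists_adj_of_nontrivial v) hτ
    (α := α) ?_ S ?_ (fun d => amalgamMk a₁ a₁' a₂ a₂' (gl d)) (fun d hd => apply_eq_of_mem_dead cτ hd) ?_ ?_ ?_ ?_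
  · rintro ((d | d) | ⟨k, t⟩)
    · rfl
    · rfl
    · rw [g4, g4, Bool.not_not]
  · rintro ((d | d) | k) h
    · change d.symm.edge ∈ ({s(a₁, b₁), s(b₁, b₁')} : Set (Sym2 V₁))
      rw [Dart.edge_symm]
      exact h
    · change d.symm.edge ∈ ({s(a₂, b₂), s(b₂, b₂'), s(a₂, a₂')} : Set (Sym2 V₂))
      rw [Dart.edge_symm]
      exact h
    · exact h
  · intro d hd e he
    rw [amalgamMk_eq_iff na₂]
    have := Setoid.ext_iff.1 cτ d e
    rw [Setoid.ker_def, deadLabel_eq_iff] at this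
    refine this.trans ⟨?_, fun h => Or.inr ⟨hd, he, h⟩⟩
    rintro (rfl | h)
    · rfl
    · exact h.2.2
  · rintro ((d | d) | ⟨k, t⟩) hd
    all_goals refine amalgam_adj_of na na₂ (by grind) (by grind) ?_
    · rw [g1, g1', preAmalgam_adj_inl]
      exact ⟨d.adj, hd⟩
    · rw [g2, g2', preAmalgam_adj_inr]
      exact ⟨d.adj, fun h => hd (h.imp_right Or.inl)⟩
    · cases t
      · exact chord_adj k
      · exact (chord_adj k).symm
  · rintro _ _ ⟨-, x, y, hxy, rfl, rfl⟩
    have chords : ∀ {u v}, (preAmalgam G₁ a₁ b₁ b₁' G₂ a₂ b₂ b₂').Adj (.inl u) (.inr v) →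
        ∃ k, ![b₁', b₁, b₁] k = u ∧ ![b₂, b₂, b₂'] k = v := by
      intro u v h
      rcases preAmalgam_adj_inl_inr.1 h with ⟨rfl, rfl⟩ | ⟨rfl, rfl⟩ | ⟨rfl, rfl⟩
      exacts [⟨1, rfl, rfl⟩, ⟨2, rfl, rfl⟩, ⟨0, rfl, rfl⟩]
    have alive : ∀ {u v} (h : G₁.Adj u v), s(u, v) = s(a₁, a₁') →
        (Sum.inl (Sum.inl ⟨(u, v), h⟩) : (G₁.Dart ⊕ G₂.Dart) ⊕ (Fin 3 × Bool)) ∉ S := by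
      intro u v h he hS
      have hS : s(u, v) ∈ ({s(a₁, b₁), s(b₁, b₁')} : Set (Sym2 V₁)) := hS
      rw [he] at hS
      simp only [Set.mem_insert_iff, Set.mem_singleton_iff, Sym2.eq_iff] at hS
      grind
    rcases x with x | x <;> rcases y with y | y
    · rw [preAmalgam_adj_inl] at hxy
      exact ⟨.inl (.inl ⟨(x, y), hxy.1⟩), hxy.2, rfl, rfl⟩
    · obtain ⟨k, rfl, rfl⟩ := chords hxy
      exact ⟨.inr (k, false), id, rfl, rfl⟩
    · obtain ⟨k, rfl, rfl⟩ := chords hxy.symm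
      exact ⟨.inr (k, true), id, rfl, rfl⟩
    · rw [preAmalgam_adj_inr] at hxy
      -- The dead edge `a₂a₂'` is represented by its twin `a₁a₁'`.
      by_cases he : s(x, y) = s(a₂, a₂')
      · rcases Sym2.eq_iff.1 he with ⟨rfl, rfl⟩ | ⟨rfl, rfl⟩
        · exact ⟨.inl (.inl ⟨(a₁, a₁'), haa₁⟩), alive _ rfl, Quot.sound .a, Quot.sound .a'⟩
        · exact ⟨.inl (.inl ⟨(a₁', a₁), haa₁.symm⟩), alive _ Sym2.eq_swap, Quot.sound .a',
            Quot.sound .a⟩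
      · refine ⟨.inl (.inr ⟨(x, y), hxy.1⟩), ?_, rfl, rfl⟩
        rintro (h | h | h)
        · exact hxy.2 (Or.inl h)
        · exact hxy.2 (Or.inr h)
        · exact he h
  -- There are no parallel live edges: an edge of `G₂` that coincides with one of `G₁` must be
  -- `a₂a₂'`, and every new edge joins the two sides without becoming an edge of either.
  · have x12 : ∀ (d : G₁.Dart) (e : G₂.Dart),
        identify a₁ a₁' a₂ a₂' (.inr e.fst) = .inl d.fst →
        identify a₁ a₁' a₂ a₂' (.inr e.snd) = .inl d.snd → Sum.inl (Sum.inr e) ∈ S := by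
      intro d e h h'
      rw [identify_inr_eq_inl na₂] at h h'
      have := e.adj.ne
      refine Or.inr (Or.inr ?_)
      change s(e.fst, e.snd) = s(a₂, a₂')
      rw [Sym2.eq_iff]
      grind
    have x13 : ∀ (u : V₁) k, identify a₁ a₁' a₂ a₂' (.inr (![b₂, b₂, b₂'] k)) ≠ .inl u := by
      intro u k h
      rw [identify_inr_eq_inl na₂] at h
      exact h.elim (fun h => hk.1 h.1) fun h => hk.2 h.1
    have x23 : ∀ (v : V₂) k, identify a₁ a₁' a₂ a₂' (.inr v) ≠ .inl (![b₁', b₁, b₁] k) := by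
      intro v k h
      rw [identify_inr_eq_inl na₂] at h
      exact h.elim (fun h => hb₁k.1 h.2) fun h => hb₁k.2 h.2
    intro d hd e he h h'
    rw [amalgamMk_eq_iff na₂] at h h'
    rcases d with (d | d) | ⟨k, t⟩ <;> rcases e with (e | e) | ⟨k', t'⟩
    · rw [g1, g1, identify_inl, identify_inl] at h
      rw [g1', g1', identify_inl, identify_inl] at h'
      rw [Dart.ext d e (Prod.ext (Sum.inl_injective h) (Sum.inl_injective h'))]
    · rw [g1, g2, identify_inl] at h
      rw [g1', g2', identify_inl] at h'
      exact absurd (x12 d e h.symm h'.symm) he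
    · rw [g1, identify_inl] at h
      rw [g1', g4, identify_inl] at h'
      cases t'
      · exact absurd h'.symm (x13 _ _)
      · exact absurd h.symm (x13 _ _)
    · rw [g1, g2, identify_inl] at h
      rw [g1', g2', identify_inl] at h'
      exact absurd (x12 e d h h') hd
    · rw [g2, g2] at h
      rw [g2', g2'] at h'
      rw [Dart.ext d e (Prod.ext (identify_inr_injective na₂ na h)
        (identify_inr_injective na₂ na h'))]
    · rw [g2] at h
      rw [g2', g4] at h'
      cases t'
      · rw [g3, identify_inl] at h
        exact absurd h (x23 _ _)
      · rw [Bool.not_true, g3, identify_inl] at h'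
        exact absurd h' (x23 _ _)
    · rw [g1, identify_inl] at h
      rw [g1', g4, identify_inl] at h'
      cases t
      · exact absurd h' (x13 _ _)
      · exact absurd h (x13 _ _)
    · rw [g2] at h
      rw [g2', g4] at h'
      cases t
      · rw [g3, identify_inl] at h
        exact absurd h.symm (x23 _ _)
      · rw [Bool.not_true, g3, identify_inl] at h'
        exact absurd h'.symm (x23 _ _)
    · rw [g4, g4] at h'
      cases t <;> cases t'
      · rw [g3, g3, identify_inl, identify_inl] at h
        rw [Bool.not_false, g3', g3'] at h'
        rw [hkinj (Sum.inl_injective h) (identify_inr_injective na₂ na h')]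
      · rw [g3, g3', identify_inl] at h
        exact absurd h.symm (x13 _ _)
      · rw [g3, g3', identify_inl] at h
        exact absurd h (x13 _ _)
      · rw [Bool.not_true, g3, g3, identify_inl, identify_inl] at h'
        rw [g3', g3'] at h
        rw [hkinj (Sum.inl_injective h') (identify_inr_injective na₂ na h)]

end PlaneGraph

theorem mainTheorem11 {V₁ V₂ : Type*} [Fintype V₁] [Fintype V₂]
    (G₁ : SimpleGraph V₁) [DecidableRel G₁.Adj] (G₂ : SimpleGraph V₂) [DecidableRel G₂.Adj]
    (hconn₁ : G₁.Connected) (hconn₂ : G₂.Connected)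
    (a₁ a₁' b₁ b₁' : V₁) (a₂ a₂' b₂ b₂' : V₂)
    (hglue₁ : PlaneGraph.GluingProperty G₁ a₁ a₁' b₁ b₁')
    (hglue₂ : PlaneGraph.GluingProperty G₂ a₂ a₂' b₂ b₂')
    (hemb₁ : ∃ (E : PlaneGraph.PlaneEmbedding G₁) (F : E.Face),
      E.OnFace F ![a₁', a₁, b₁, b₁'] ∧ E.AppearInOrder F ![a₁', a₁, b₁, b₁'])
    (hemb₂ : ∃ E : PlaneGraph.PlaneEmbedding G₂, ¬ E.CoFacial ![a₂, a₂', b₂, b₂']) :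
    PlaneGraph.Planar (PlaneGraph.amalgam G₁ a₁ a₁' b₁ b₁' G₂ a₂ a₂' b₂ b₂') := by
  classical
  have n₁ := hglue₁.distinct
  have n₂ := hglue₂.distinct
  simp only [List.nodup_cons, List.mem_cons, List.not_mem_nil, or_false, not_or,
    List.nodup_nil, and_true, not_false_eq_true] at n₁ n₂
  obtain ⟨E₁, F, hF, hord⟩ := hemb₁
  obtain ⟨E₂, hE₂⟩ := hemb₂
  obtain ⟨w, ha, hb⟩ : ∃ w : G₁.Walk b₁' a₁', a₁ ∉ w.support ∧ b₁ ∉ w.support := by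
    -- Since `3 + 1 = 0` in `Fin 4`, this is the path from `b₁'` to `a₁'`; it avoids `a₁` and `b₁`,
    -- which have indices 1 and 2.
    obtain ⟨p, -, -, hp⟩ := hord 3
    exact ⟨p, fun h => absurd (hp 1 h) (by decide), fun h => absurd (hp 2 h) (by decide)⟩
  obtain ⟨A', hA'F, hA'⟩ := hF 0
  obtain ⟨A, hAF, hA⟩ := hF 1
  obtain ⟨B, hBF, hB⟩ := hF 2
  obtain ⟨B', hB'F, hB'⟩ := hF 3
  change A'.fst = a₁' at hA'
  change A.fst = a₁ at hA
  change B.fst = b₁ at hB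
  change B'.fst = b₁' at hB'
  have hsame : ∀ {d}, E₁.faceOfDart d = F →
      (E₁.rot * PlaneGraph.revPerm G₁).SameCycle A d := fun hd =>
    Quotient.exact (hAF.trans hd.symm)
  have hv : ∀ v, ∃ d : G₁.Dart, d.fst = v := fun v => by
    have : Nontrivial V₁ := ⟨a₁, b₁, hglue₁.adj_ab.ne⟩
    obtain ⟨w, hw⟩ := hconn₁.preconnected.exists_adj_of_nontrivial v
    exact ⟨⟨(v, w), hw⟩, rfl⟩
  have hs₁ := (PlaneGraph.euler_iff_isSpherical hconn₁ hv E₁.sameCycle_rot_iff).1 E₁.euler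
  have hlist₁ := PlaneGraph.exists_isCyc_of_onFace (A := A) (A' := A') (B := B) (B' := B') hs₁
    E₁.sameCycle_rot_iff
    (by rw [hA, hA']; exact hglue₁.adj_aa') (by rw [hB, hB']; exact hglue₁.adj_bb')
    (by rw [hA, hB]; exact hglue₁.adj_ab) (by rw [hA, hB']; exact n₁.1.2.2)
    (by rw [hA', hB]; exact n₁.2.1.1) (by rw [hA', hB']; exact n₁.2.1.2)
    (w.copy hB'.symm hA'.symm) (by rw [SimpleGraph.Walk.support_copy, hA]; exact ha)
    (by rw [SimpleGraph.Walk.support_copy, hB]; exact hb) (hsame hA'F) (hsame hBF) (hsame hB'F)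
  rw [hA, hA', hB, hB'] at hlist₁
  clear! A A' B B'
  obtain ⟨σ₁, A, A', B, B', l₁, l₂, l₃, l₄, hσ₁, hc₁, hA, hA', hB, hB', hl⟩ := hlist₁
  obtain ⟨σ₂, C, C', E, E', m₁, m₂, m₃, m₄, hσ₂, hc₂, hC, hC', hE, hE', hCb, hEa, hm⟩ :=
    PlaneGraph.exists_isCyc_deleted_of_not_coFacial E₂ hconn₂ hE₂ hglue₂.adj_ab hglue₂.adj_aa'
      hglue₂.adj_bb' n₂.1.2.2 n₂.2.1.1 hglue₂.degree_a.le hglue₂.degree_b.le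
  have hdead : ∀ d : G₂.Dart, ¬ (d.fst = b₂ ∧ d.snd = a₂) → ¬ (d.fst = a₂ ∧ d.snd = b₂) →
      d ∉ ({⟨(b₂, a₂), hglue₂.adj_ab.symm⟩, ⟨(a₂, b₂), hglue₂.adj_ab⟩} : Set G₂.Dart) := by
    rintro d h1 h2 (rfl | rfl)
    · exact h1 ⟨rfl, rfl⟩
    · exact h2 ⟨rfl, rfl⟩
  obtain ⟨σ, hs, hσ⟩ := PlaneGraph.exists_glue hσ₁ hσ₂ (lab₁ := fun d => d.fst)
    (Setoid.ext hc₁) hc₂ hl hm (hdead C (by grind) (by grind)) (hdead C' (by grind) (by grind))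
    (hdead E (by grind) (by grind)) (hdead E' (by grind) (by grind)) (by grind)
  simp only [hA, hA', hB, hB', hC, hC', hE, hE'] at hσ
  refine PlaneGraph.planar_amalgam hglue₁.distinct hglue₂.distinct hglue₁.adj_aa' hglue₂.adj_aa'
    ?_ hs ?_ hσ
  · exact PlaneGraph.amalgam_connected hconn₁ hconn₂ n₁.1.1 n₂.1.1 (by grind) (by grind)
      hglue₁.adj_aa' w hb
  · rintro d (rfl | rfl)
    · exact Sym2.eq_swap
    · rfl
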